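/- For real numbers $a,b$ let $V=V_{a,b}$ be the potential with $V(1)=a$, $V(2)=b$ and $$V(n)=\frac{(-1)^n}{n}\left(1+\frac{2}{\ln n}\right)\qquad (n\ge 3),$$ and let $H=H_{a,b}$ be the bounded self-adjoint operator on $\ell_2(\{1,2,3,\dots\})$ given by $(Hu)(n)=u(n+1)+u(n-1)+V(n)u(n)$ for $n\ge 2$ and $(Hu)(1)=u(2)+V(1)u(1)$. (1) For all $a,b$, the equation $u(n+1)+u(n-1)+V(n)u(n)=Eu(n)$ $(n\ge 1)$ with $E=0$ has a solution $u=(u(n))_{n\ge 0}$, not identically zero, with $\sum_n |u(n)|^2<\infty$. (2) For all $a,b$, the spectrum of $H$ is the union of $[-2,2]$ and an infinite set $\{E_1,E_2,\dots\}$ of distinct simple eigenvalues outside $[-2,2]$, which can be numbered such that $d_n=\operatorname{dist}(E_n,[-2,2])$ satisfies $d_1\ge d_2\ge\dots$. If $a=b=0$, there is a $c>0$ such that $$d_n\le e^{-cn^2}\qquad\text{for all } n\ge 1.$$ For general $a,b$ there are $c>0$ and $C$ (depending on $a,b$) such that $d_n\le Ce^{-cn^2}$ for all $n\ge 1$. (3)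 There is a value $V(1)=a$ such that, with $b=V(2)=0$, the number $0$ is an eigenvalue of $H_{a,0}$. In particular, the spectrum of $H_{a,0}$ is not purely absolutely continuous on $[-2,2]$ (that is, not all spectral measures of $H_{a,0}$ are absolutely continuous with respect to Lebesgue measure on $[-2,2]$), although $\sum_n 1/\ln (d_n^{-1})<\infty$. This disproves Simon's conjecture that $\sum_n 1/\ln (d_n^{-1})<\infty$ implies that the spectrum is purely absolutely continuous on $[-2,2]$. (Finitely many terms with $d_n\ge 1$ are irrelevant here; a term with $d_n=1$ is read as $0$.) -/

import Mathlib

namespace DiscreteSchrodinger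

/-- The Hilbert space `ℓ₂` over the half line `{1, 2, 3, …}`. The coordinate with index `k : ℕ`
is the value at the site `n = k + 1`. -/
abbrev HalfLine : Type := lp (fun _ : ℕ => ℂ) 2

/-- The Schrödinger difference expression with Dirichlet condition at the site `0`, where the index
`k` stands for the site `n = k + 1`:
`(Hu)(n) = u(n+1) + u(n-1) + V(n) u(n)` for `n ≥ 2` and `(Hu)(1) = u(2) + V(1) u(1)`. -/
def expr (V : ℕ → ℝ) (u : ℕ → ℂ) : ℕ → ℂ
  | 0 => u 1 + (V 1 : ℂ) * u 0
  | k + 1 => u (k + 2) + u k + (V (k + 2) : ℂ) * u (k + 1)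

theorem expr_eq (V : ℕ → ℝ) (u : ℕ → ℂ) (k : ℕ) :
    expr V u k = u (k + 1) + (if k = 0 then 0 else u (k - 1)) + (V (k + 1) : ℂ) * u k := by
  cases k <;> simp [expr]

theorem memlp_iff (u : ℕ → ℂ) : Memℓp u 2 ↔ Summable fun k => ‖u k‖ ^ 2 := by
  rw [memℓp_gen_iff (by norm_num)]
  norm_num

theorem memlp_expr {V : ℕ → ℝ} {M : ℝ} (hM : ∀ n, |V n| ≤ M) {u : ℕ → ℂ} (hu : Memℓp u 2) :
    Memℓp (expr V u) 2 := by
  have h1 : Memℓp (fun k => u (k + 1)) 2 := by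
    rw [memlp_iff] at hu ⊢
    exact (summable_nat_add_iff 1).2 hu
  have h2 : Memℓp (fun k => if k = 0 then 0 else u (k - 1)) 2 := by
    rw [memlp_iff] at hu ⊢
    refine (summable_nat_add_iff 1).1 ?_
    simpa using hu
  have h3 : Memℓp (fun k => (V (k + 1) : ℂ) * u k) 2 := by
    rw [memlp_iff] at hu ⊢
    refine Summable.of_nonneg_of_le (fun k => by positivity) (fun k => ?_) (hu.mul_left (M ^ 2))
    rw [norm_mul, mul_pow, Complex.norm_real, Real.norm_eq_abs]
    gcongr
    exact hM _
  have h : expr V u = ((fun k => u (k + 1)) + fun k => if k = 0 then 0 else u (k - 1)) +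
      fun k => (V (k + 1) : ℂ) * u k := by
    funext k
    simp [expr_eq]
  rw [h]
  exact (h1.add h2).add h3

/-- The operator `H` as a linear map of `ℓ₂`, for a bounded potential `V`. -/
def linearH (V : ℕ → ℝ) (hV : ∃ M, ∀ n, |V n| ≤ M) : HalfLine →ₗ[ℂ] HalfLine where
  toFun u := ⟨expr V u, memlp_expr hV.choose_spec (lp.memℓp u)⟩
  map_add' u v := by
    ext k
    simp only [lp.coeFn_add, Pi.add_apply, expr_eq]
    split_ifs <;> ring
  map_smul' c u := by
    ext k
    simp only [lp.coeFn_smul, Pi.smul_apply, expr_eq, smul_eq_mul, RingHom.id_apply]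
    split_ifs <;> ring

theorem continuous_coord (k : ℕ) : Continuous fun u : HalfLine => u k :=
  (continuous_apply k).comp (lp.uniformContinuous_coe (p := 2)).continuous

/-- The half-line Schrödinger operator `H` with bounded potential `V`, as a bounded operator
on `ℓ₂`. -/
noncomputable def opH (V : ℕ → ℝ) (hV : ∃ M, ∀ n, |V n| ≤ M) : HalfLine →L[ℂ] HalfLine :=
  ContinuousLinearMap.ofSeqClosedGraph (g := linearH V hV) (by
    intro u x y hu hy
    ext k
    have hc : ∀ j, Filter.Tendsto (fun n => u n j) Filter.atTop (nhds (x j)) := fun j =>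
      ((continuous_coord j).tendsto x).comp hu
    have h1 : Filter.Tendsto (fun n => linearH V hV (u n) k) Filter.atTop (nhds (y k)) :=
      ((continuous_coord k).tendsto y).comp hy
    refine tendsto_nhds_unique h1 ?_
    change Filter.Tendsto (fun n => expr V (u n) k) Filter.atTop (nhds (expr V x k))
    cases k with
    | zero => exact (hc 1).add ((hc 0).const_mul _)
    | succ k => exact ((hc (k + 2)).add (hc k)).add ((hc (k + 1)).const_mul _))

theorem opH_apply (V : ℕ → ℝ) (hV : ∃ M, ∀ n, |V n| ≤ M) (u : HalfLine) (k : ℕ) :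
    opH V hV u k = expr V u k := rfl

/-- The potential with `V(1) = a`, `V(2) = b` and `V(n) = (-1)ⁿ / n · (1 + 2 / ln n)` for `n ≥ 3`
(the value at `n = 0` plays no role). -/
noncomputable def pot (a b : ℝ) (n : ℕ) : ℝ :=
  if n = 1 then a else if n = 2 then b else (-1) ^ n / (n : ℝ) * (1 + 2 / Real.log n)

theorem pot_bounded (a b : ℝ) : ∃ M, ∀ n, |pot a b n| ≤ M := by
  refine ⟨|a| + |b| + 1, fun n => ?_⟩
  have ha := abs_nonneg a
  have hb := abs_nonneg b
  unfold pot
  split_ifs with h1 h2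
  · linarith
  · linarith
  · rcases Nat.eq_zero_or_pos n with h0 | h0
    · subst h0
      simp
      positivity
    · have h3 : (3 : ℝ) ≤ n := by
        exact_mod_cast (by omega : 3 ≤ n)
      have hl : 1 ≤ Real.log n := by
        rw [Real.le_log_iff_exp_le (by linarith)]
        linarith [Real.exp_one_lt_d9]
      have hq : 2 / Real.log n ≤ 2 := by
        rw [div_le_iff₀ (by linarith)]
        linarith
      have hq0 : 0 ≤ 2 / Real.log n := by positivity
      have : |(-1) ^ n / (n : ℝ) * (1 + 2 / Real.log n)| ≤ 1 := by
        rw [abs_mul, abs_div, abs_pow, abs_neg, abs_one, one_pow, Nat.abs_cast,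
          abs_of_nonneg (by linarith : 0 ≤ 1 + 2 / Real.log n), div_mul_eq_mul_div,
          div_le_one (by linarith)]
        linarith
      linarith

/-- The operator `H` with the potential `pot a b`. -/
noncomputable def opPot (a b : ℝ) : HalfLine →L[ℂ] HalfLine := opH (pot a b) (pot_bounded a b)

/-- The distance of the energy `x` from the interval `[-2, 2]`. -/
noncomputable def edgeDist (x : ℝ) : ℝ := Metric.infDist x (Set.Icc (-2) 2)

/-- `E 0, E 1, E 2, …` are infinitely many distinct points outside `[-2, 2]`, each of them is a
simple eigenvalue of `H`, the spectrum of `H` is the union of `[-2, 2]` and these points, and they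
are listed in the order of non-increasing distance from `[-2, 2]`. -/
def EnumeratesDiscreteSpectrum (H : HalfLine →L[ℂ] HalfLine) (E : ℕ → ℝ) : Prop :=
  Function.Injective E ∧ (∀ n, E n ∉ Set.Icc (-2 : ℝ) 2) ∧
    (∀ n, Module.finrank ℂ (Module.End.eigenspace (H : HalfLine →ₗ[ℂ] HalfLine) (E n : ℂ)) = 1) ∧
    spectrum ℂ H = (fun x : ℝ => (x : ℂ)) '' (Set.Icc (-2) 2 ∪ Set.range E) ∧
    Antitone fun n => edgeDist (E n)

/-- `μ` is the spectral measure of the bounded self-adjoint operator `H` and the vector `ψ`: the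
(unique) finite, compactly supported Borel measure on the line with
`⟨ψ, H ^ k ψ⟩ = ∫ x ^ k dμ(x)` for all `k`. -/
def IsSpectralMeasure (H : HalfLine →L[ℂ] HalfLine) (ψ : HalfLine)
    (μ : MeasureTheory.Measure ℝ) : Prop :=
  MeasureTheory.IsFiniteMeasure μ ∧ (∃ R : ℝ, μ (Set.Icc (-R) R)ᶜ = 0) ∧
    ∀ k : ℕ, inner ℂ ψ ((H ^ k) ψ) = ((∫ x, x ^ k ∂μ : ℝ) : ℂ)

/-- The spectrum of `H` is purely absolutely continuous on `S`: all spectral measures are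
absolutely continuous there. -/
def PurelyAbsolutelyContinuousOn (H : HalfLine →L[ℂ] HalfLine) (S : Set ℝ) : Prop :=
  ∀ (ψ : HalfLine) (μ : MeasureTheory.Measure ℝ), IsSpectralMeasure H ψ μ →
    MeasureTheory.Measure.AbsolutelyContinuous (μ.restrict S) MeasureTheory.volume

end DiscreteSchrodinger

/-!
The edges `±2` of the essential spectrum feel the oscillating potential `(-1)ⁿ W(n)`,
`W(n) = (1/n)(1 + 2/ln n)`, only in second order. With `s = ± (-1)ⁿ` the function
`g(n) = √n (1 + s W(n)/4)` is an approximate solution at an edge, and writing `u = g y` turns the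
form of `H ∓ 2` exactly into `∑ ρ(n) y(n)² - ∑ g(n) g(n+1) (y(n+1) - y(n))²` (`sum_form_eq`), where
the Hardy-critical part `1/(4n²)` of the attraction `W²/4` has cancelled. What remains is
`ρ(n) ∼ 1/(n ln n)` and `g(n) g(n+1) ∼ n` (`groundState_estimates`), so in the variable `t = ln n` the
problem is `-y'' - y/t`.

* Upper bound for the number of eigenvalues: a block of `t`-length of the order `√t` with a Dirichlet
  condition at its left end carries no energy beyond the edge (`block_inequality`), and beyond
  `t ≈ M²/100` the effective potential is at most `4 exp(-M²/50)` relative to the weight `g²`. The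
  blocks may be cut at `t = j²/100`, so about `M` linear conditions suffice (`form_le_of_cuts`), and only `O(M)`
  eigenvalues can be farther than `4 exp(-M²/50)` from `[-2, 2]` (`exists_count_bound`).
* Infinitely many eigenvalues: a trapezoid in `ln n` of length comparable to its distance from the
  origin has kinetic energy of the order `1/T` but gains a constant from `ρ` (`exists_trial`). If
  there were only finitely many eigenvalues above `2`, subtracting their spectral part would be a
  compact perturbation, and the form would still exceed `2` at a combination of such trial vectors,
  which produces one more eigenvalue (`infinite_eigenvalues`).
* The spectrum itself: the potential is a compact operator, so outside `[-2, 2]` the Fredholm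
  alternative applies, and cut-off plane waves show that `[-2, 2]` belongs to the spectrum.
* At energy zero, `u(n) = (-1)^⌊n/2⌋ z(n)` reduces the equation to `z(n+1) = z(n-1) - W(n) z(n)`. The
  same recursion with the opposite sign has a solution growing like `√n ln n`
  (`sqrt_mul_log_subsolution`), and reduction of order gives `z(n) = O(1/(√n ln n))`, which is square
  summable (`exists_l2_tail`). The value `V(1)` then adjusts the boundary condition, and the spectral
  measure of the eigenvector is a point mass at `0`.
-/

namespace DiscreteSchrodinger

open Filter Topology

/-! ### A square-summable solution at energy zero -/

/-- The modulus `(1/n)(1 + 2/ln n)` of the oscillating potential at the site `n`. -/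
noncomputable def osc (x : ℝ) : ℝ := 1 / x * (1 + 2 / Real.log x)

theorem pot_eq_osc (a b : ℝ) {n : ℕ} (hn : 3 ≤ n) : pot a b n = (-1) ^ n * osc n := by
  unfold pot osc
  rw [if_neg (by omega), if_neg (by omega)]
  ring

theorem osc_pos {x : ℝ} (hx : 1 < x) : 0 < osc x := by
  have := Real.log_pos hx
  have : 0 < x := by linarith
  unfold osc
  positivity

/-- A positive solution `p` of `p (k+2) = p k + w (k+1) p (k+1)` that grows fast enough yields a
positive solution of the recursion with the sign of `w` reversed, by reduction of order: the
Casoratian of two solutions alternates in sign, so the second solution is `p` times an alternating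
series. -/
theorem exists_decaying_solution {w p : ℕ → ℝ} (hw : ∀ k, 0 < w k) (hp : ∀ k, 0 < p k)
    (hrec : ∀ k, p (k + 2) = p k + w (k + 1) * p (k + 1))
    (hs : Summable fun k => 1 / (p k * p (k + 1))) :
    ∃ z : ℕ → ℝ, (∀ k, 0 < z k) ∧ (∀ k, z (k + 2) = z k - w (k + 1) * z (k + 1)) ∧
      ∀ k, z k ≤ 1 / p (k + 1) := by
  set a : ℕ → ℝ := fun k => 1 / (p k * p (k + 1)) with ha
  have hapos : ∀ k, 0 < a k := fun k => one_div_pos.2 (mul_pos (hp _) (hp _))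
  have hlt : ∀ k, a (k + 1) < a k := by
    intro k
    have h1 := hp k
    have h2 := hp (k + 1)
    have h3 := mul_pos (hw (k + 1)) h2
    have h4 := hrec k
    refine one_div_lt_one_div_of_lt (mul_pos h1 h2) ?_
    rw [mul_comm (p k)]
    exact mul_lt_mul_of_pos_left (by linarith) h2
  have hanti : Antitone a := antitone_nat_of_succ_le fun k => (hlt k).le
  have hsum : ∀ n, Summable fun i => (-1 : ℝ) ^ i * a (n + i) := by
    intro n
    refine Summable.of_norm ?_
    have : (fun i => ‖(-1 : ℝ) ^ i * a (n + i)‖) = fun i => a (i + n) := by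
      funext i
      rw [norm_mul, norm_pow, norm_neg, norm_one, one_pow, one_mul, Real.norm_of_nonneg
        (hapos _).le, add_comm]
    rw [this]
    exact (summable_nat_add_iff n).2 hs
  set R : ℕ → ℝ := fun n => ∑' i, (-1 : ℝ) ^ i * a (n + i) with hR
  have hRpos : ∀ n, 0 < R n := by
    intro n
    have h1 := Antitone.alternating_series_le_tendsto (hsum n).hasSum.tendsto_sum_nat
      (fun i j hij => hanti (by omega)) 1
    have h2 : ∑ i ∈ Finset.range (2 * 1), (-1 : ℝ) ^ i * a (n + i) = a n - a (n + 1) := by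
      simp [Finset.sum_range_succ]
      ring
    rw [h2] at h1
    have := hlt n
    have h3 : a n - a (n + 1) ≤ R n := h1
    linarith
  have hRadd : ∀ n, R n + R (n + 1) = a n := by
    intro n
    have h1 : R n = a n + ∑' i, (-1 : ℝ) ^ (i + 1) * a (n + (i + 1)) := by
      rw [hR]
      simp only
      rw [(hsum n).tsum_eq_zero_add]
      simp
    have h2 : ∑' i, (-1 : ℝ) ^ (i + 1) * a (n + (i + 1)) = - R (n + 1) := by
      rw [hR]
      simp only
      rw [← tsum_neg]
      congr 1
      funext i
      rw [show n + (i + 1) = n + 1 + i by ring]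
      ring
    linarith
  refine ⟨fun k => p k * R k, fun k => mul_pos (hp k) (hRpos k), fun k => ?_, fun k => ?_⟩
  · have h1 := hRadd k
    have h2 := hRadd (k + 1)
    have h3 : p (k + 1) * p (k + 2) * a (k + 1) = 1 := by
      have := hp (k + 1)
      have := hp (k + 2)
      simp only [ha]
      field_simp
    have h4 : p k * p (k + 1) * a k = 1 := by
      have := hp (k + 1)
      have := hp k
      simp only [ha]
      field_simp
    have h5 : p (k + 1) * (p (k + 2) * R (k + 2)) =
        p (k + 1) * (p k * R k - w (k + 1) * (p (k + 1) * R (k + 1))) := by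
      have e1 : R (k + 2) = a (k + 1) - R (k + 1) := by linarith
      have e2 : R k = a k - R (k + 1) := by linarith
      rw [e1, e2]
      have := hrec k
      linear_combination h3 - h4 - p (k + 1) * R (k + 1) * this
    exact mul_left_cancel₀ (hp (k + 1)).ne' h5
  · have h1 := hRadd k
    have h2 := hRpos (k + 1)
    have h3 : R k ≤ a k := by linarith
    calc p k * R k ≤ p k * a k := mul_le_mul_of_nonneg_left h3 (hp k).le
      _ = 1 / p (k + 1) := by
        have := hp (k + 1)
        have := hp k
        simp only [ha]
        field_simp

theorem summable_inv_mul_log_sq :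
    Summable fun n : ℕ => 1 / (((n : ℝ) + 2) * (Real.log ((n : ℝ) + 2) + 1) ^ 2) := by
  refine summable_of_sum_range_le (c := 1) (fun n => ?_) (fun n => ?_)
  · have : 0 ≤ Real.log ((n : ℝ) + 2) := Real.log_nonneg (by linarith [n.cast_nonneg (α := ℝ)])
    positivity
  · suffices h : ∑ i ∈ Finset.range n, 1 / (((i : ℝ) + 2) * (Real.log ((i : ℝ) + 2) + 1) ^ 2) ≤
        1 - 1 / (Real.log ((n : ℝ) + 1) + 1) by
      have : 0 ≤ Real.log ((n : ℝ) + 1) := Real.log_nonneg (by linarith [n.cast_nonneg (α := ℝ)])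
      have : 0 ≤ 1 / (Real.log ((n : ℝ) + 1) + 1) := by positivity
      linarith
    induction n with
    | zero => simp
    | succ n ih =>
      rw [Finset.sum_range_succ]
      refine (add_le_add_left ih _).trans ?_
      have hn : (0 : ℝ) ≤ n := n.cast_nonneg
      push_cast
      rw [show (n : ℝ) + 1 + 1 = n + 2 by ring]
      set l := Real.log ((n : ℝ) + 1) with hl
      set m := Real.log ((n : ℝ) + 2) with hm
      have hl0 : 0 ≤ l := Real.log_nonneg (by linarith)
      have hlm : 1 / ((n : ℝ) + 2) ≤ m - l := by
        have := Real.one_sub_inv_le_log_of_pos (x := ((n : ℝ) + 2) / (n + 1)) (by positivity)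
        rw [Real.log_div (by positivity) (by positivity)] at this
        refine le_trans (le_of_eq ?_) this
        field_simp
        ring
      have hpos : 0 < 1 / ((n : ℝ) + 2) := by positivity
      have h1 : 1 / (((n : ℝ) + 2) * (m + 1) ^ 2) ≤ (m - l) / ((l + 1) * (m + 1)) := by
        rw [← div_div]
        have hm0 : 0 ≤ m := by linarith
        refine div_le_div₀ (by linarith) hlm (by positivity) ?_
        nlinarith
      have h2 : (m - l) / ((l + 1) * (m + 1)) = 1 / (l + 1) - 1 / (m + 1) := by
        have : 0 < m := by linarith
        field_simp
        ring
      linarith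

/-- The function `√x (ln x + 1)` is a subsolution of the growing recursion. -/
theorem sqrt_mul_log_subsolution : ∀ᶠ n : ℕ in Filter.atTop,
    √((n : ℝ) + 1) * (Real.log ((n : ℝ) + 1) + 1) ≤
      √((n : ℝ) - 1) * (Real.log ((n : ℝ) - 1) + 1) + osc n * (√n * (Real.log n + 1)) := by
  have hlog : ∀ᶠ x : ℝ in Filter.atTop, Real.log x ^ 2 + 4 * Real.log x + 2 ≤ 2 * x := by
    have h1 := (Real.isLittleO_pow_log_id_atTop (n := 2)).bound (show (0 : ℝ) < 1 / 7 by norm_num)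
    filter_upwards [h1, Filter.eventually_ge_atTop (Real.exp 1)] with x hx hx1
    have hx0 : 0 < x := (Real.exp_pos 1).trans_le hx1
    have hl : 1 ≤ Real.log x := (Real.le_log_iff_exp_le hx0).2 hx1
    simp only [id, Real.norm_eq_abs] at hx
    rw [abs_of_nonneg (by positivity), abs_of_pos hx0] at hx
    nlinarith
  filter_upwards [tendsto_natCast_atTop_atTop.eventually hlog, Filter.eventually_ge_atTop 3]
    with n hn hn3
  have hn3' : (3 : ℝ) ≤ n := by exact_mod_cast hn3
  set x : ℝ := (n : ℝ)
  have hder : ∀ y ∈ Set.Ioo (x - 1) (x + 1), HasDerivAt (fun y => √y * (Real.log y + 1))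
      ((Real.log y + 3) / (2 * √y)) y := by
    intro y hy
    have hy0 : 0 < y := by linarith [hy.1]
    have h := (Real.hasDerivAt_sqrt hy0.ne').mul ((Real.hasDerivAt_log hy0.ne').add_const 1)
    refine h.congr_deriv ?_
    have h3 : √y ≠ 0 := (Real.sqrt_pos.2 hy0).ne'
    rw [← div_eq_mul_inv √y y, Real.sqrt_div_self']
    field_simp
    ring
  have hcont : ContinuousOn (fun y => √y * (Real.log y + 1)) (Set.Icc (x - 1) (x + 1)) := by
    refine Real.continuous_sqrt.continuousOn.mul ((Real.continuousOn_log.mono ?_).add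
      continuousOn_const)
    intro y hy
    have : 0 < y := by linarith [hy.1]
    exact this.ne'
  obtain ⟨y, hy, hy'⟩ := exists_hasDerivAt_eq_slope _ _ (by linarith) hcont hder
  rw [eq_div_iff (by linarith)] at hy'
  have hl : 0 < Real.log x := Real.log_pos (by linarith)
  have hx0 : 0 < x := by linarith
  have hy1 : √(x - 1) ≤ √y := Real.sqrt_le_sqrt hy.1.le
  have hs1 : 0 < √(x - 1) := Real.sqrt_pos.2 (by linarith)
  have hs : 0 < √x := Real.sqrt_pos.2 hx0
  have hy2 : Real.log y ≤ Real.log x + 1 / x := by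
    have h1 : Real.log y ≤ Real.log (x + 1) := Real.log_le_log (by linarith [hy.1]) hy.2.le
    have h2 := Real.log_le_sub_one_of_pos (x := (x + 1) / x) (by positivity)
    rw [Real.log_div (by positivity) (by positivity)] at h2
    have h3 : (x + 1) / x - 1 = 1 / x := by field_simp; ring
    linarith
  have hsq : √x * (1 - 1 / x) ≤ √(x - 1) := by
    have h1 : √(x - 1) = √x * √(1 - 1 / x) := by
      rw [← Real.sqrt_mul hx0.le]
      congr 1
      field_simp
    rw [h1]
    refine mul_le_mul_of_nonneg_left ?_ hs.le
    have h2 : 0 ≤ 1 - 1 / x := by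
      rw [sub_nonneg, div_le_one hx0]; linarith
    refine Real.le_sqrt_of_sq_le ?_
    have : 0 < 1 / x := by positivity
    nlinarith
  have hmain : (Real.log y + 3) / (2 * √y) * (x + 1 - (x - 1)) ≤
      osc x * (√x * (Real.log x + 1)) := by
    have h1 : (Real.log y + 3) / (2 * √y) * (x + 1 - (x - 1)) = (Real.log y + 3) / √y := by
      have : 0 < √y := hs1.trans_le hy1
      field_simp
      ring
    have h2 : osc x * (√x * (Real.log x + 1)) = (Real.log x + 3 + 2 / Real.log x) / √x := by
      unfold osc
      have h2 : √x ^ 2 = x := Real.sq_sqrt hx0.le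
      nth_rewrite 1 [← h2]
      field_simp
      ring
    rw [h1, h2]
    calc (Real.log y + 3) / √y ≤ (Real.log x + 1 / x + 3) / √(x - 1) := by
          refine div_le_div₀ (by positivity) (by linarith) hs1 hy1
      _ ≤ (Real.log x + 1 / x + 3) / (√x * (1 - 1 / x)) := by
          refine div_le_div_of_nonneg_left (by positivity) (mul_pos hs ?_) hsq
          rw [sub_pos, div_lt_one hx0]; linarith
      _ ≤ (Real.log x + 3 + 2 / Real.log x) / √x := by
          have h3 : 0 < 1 - 1 / x := by
            rw [sub_pos, div_lt_one hx0]; linarith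
          rw [mul_comm, ← div_div]
          refine div_le_div_of_nonneg_right ?_ hs.le
          rw [div_le_iff₀ h3]
          have h4 : 0 ≤ (2 * x - (Real.log x ^ 2 + 4 * Real.log x + 2)) / (x * Real.log x) :=
            div_nonneg (by linarith) (by positivity)
          have h5 : (Real.log x + 3 + 2 / Real.log x) * (1 - 1 / x) - (Real.log x + 1 / x + 3) =
            (2 * x - (Real.log x ^ 2 + 4 * Real.log x + 2)) / (x * Real.log x) := by
            field_simp
            ring
          linarith
  linarith

/-- The growing solution of `p (n+1) = p (n-1) + W(n) p n`, where the index `k` stands for the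
site `n = k + 2`. -/
noncomputable def grow : ℕ → ℝ
  | 0 => 1
  | 1 => 1
  | k + 2 => grow k + osc ((k : ℝ) + 3) * grow (k + 1)

theorem one_le_grow : ∀ k, 1 ≤ grow k := by
  intro k
  induction k using Nat.twoStepInduction with
  | zero => simp [grow]
  | one => simp [grow]
  | more k h1 h2 =>
    rw [grow]
    have := osc_pos (x := (k : ℝ) + 3) (by linarith [k.cast_nonneg (α := ℝ)])
    nlinarith [mul_pos this (show 0 < grow (k + 1) by linarith)]

theorem summable_inv_grow_sq : Summable fun k => 1 / grow k ^ 2 := by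
  obtain ⟨N, hN⟩ := Filter.eventually_atTop.1 sqrt_mul_log_subsolution
  set F : ℕ → ℝ := fun k => √((k : ℝ) + 2) * (Real.log ((k : ℝ) + 2) + 1) with hF
  have hFpos : ∀ k, 0 < F k := by
    intro k
    have hk : (0 : ℝ) ≤ k := k.cast_nonneg
    have : 0 ≤ Real.log ((k : ℝ) + 2) := Real.log_nonneg (by linarith)
    simp only [hF]
    positivity
  set c : ℝ := 1 / (F N + F (N + 1)) with hc
  have hcpos : 0 < c := one_div_pos.2 (add_pos (hFpos _) (hFpos _))
  have key : ∀ j, c * F (N + j) ≤ grow (N + j) := by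
    intro j
    induction j using Nat.twoStepInduction with
    | zero =>
      refine le_trans ?_ (one_le_grow _)
      rw [hc, one_div, inv_mul_le_iff₀ (add_pos (hFpos _) (hFpos _)), Nat.add_zero]
      linarith [hFpos (N + 1)]
    | one =>
      refine le_trans ?_ (one_le_grow _)
      rw [hc, one_div, inv_mul_le_iff₀ (add_pos (hFpos _) (hFpos _))]
      linarith [hFpos N]
    | more j h1 h2 =>
      have h3 := hN (N + j + 3) (by omega)
      have e1 : F (N + (j + 2)) ≤ F (N + j) + osc (((N + j : ℕ) : ℝ) + 3) * F (N + (j + 1)) := by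
        simp only [hF]
        push_cast at h3 ⊢
        rw [show (N : ℝ) + (j + 2) + 2 = N + j + 3 + 1 by ring,
          show (N : ℝ) + j + 2 = N + j + 3 - 1 by ring,
          show (N : ℝ) + (j + 1) + 2 = N + j + 3 by ring]
        exact h3
      have ho := osc_pos (x := ((N + j : ℕ) : ℝ) + 3)
        (by linarith [(N + j).cast_nonneg (α := ℝ)])
      rw [show N + (j + 2) = N + j + 2 by ring, grow]
      calc c * F (N + j + 2) ≤ c * (F (N + j) + osc (((N + j : ℕ) : ℝ) + 3) * F (N + (j + 1))) :=
            mul_le_mul_of_nonneg_left e1 hcpos.le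
        _ = c * F (N + j) + osc (((N + j : ℕ) : ℝ) + 3) * (c * F (N + (j + 1))) := by ring
        _ ≤ _ := add_le_add h1 (mul_le_mul_of_nonneg_left h2 ho.le)
  refine (summable_nat_add_iff N).1 ?_
  refine Summable.of_nonneg_of_le (fun k => by positivity) (fun k => ?_)
    (((summable_nat_add_iff N).2 summable_inv_mul_log_sq).mul_left (1 / c ^ 2))
  have h1 := key k
  rw [add_comm N k] at h1
  have h2 : (c * F (k + N)) ^ 2 ≤ grow (k + N) ^ 2 :=
    pow_le_pow_left₀ (mul_pos hcpos (hFpos _)).le h1 2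
  have h3 : F (k + N) ^ 2 =
      (((k + N : ℕ) : ℝ) + 2) * (Real.log (((k + N : ℕ) : ℝ) + 2) + 1) ^ 2 := by
    simp only [hF]
    rw [mul_pow, Real.sq_sqrt (by positivity)]
  calc 1 / grow (k + N) ^ 2 ≤ 1 / (c * F (k + N)) ^ 2 :=
        one_div_le_one_div_of_le (pow_pos (mul_pos hcpos (hFpos _)) 2) h2
    _ = _ := by rw [mul_pow, h3, one_div_mul_one_div]

/-- The signed solution `u` at energy zero on the sites `n = k + 2`. -/
theorem exists_l2_tail : ∃ v : ℕ → ℝ, (∀ k, v k ≠ 0) ∧ Summable (fun k => v k ^ 2) ∧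
    ∀ a b k, v (k + 2) + v k + pot a b (k + 3) * v (k + 1) = 0 := by
  have hpos : ∀ k, 0 < grow k := fun k => zero_lt_one.trans_le (one_le_grow k)
  have hs1 := (summable_nat_add_iff 1).2 summable_inv_grow_sq
  obtain ⟨z, hz0, hzr, hzb⟩ := exists_decaying_solution (w := fun k => osc ((k : ℝ) + 2)) (p := grow)
    (fun k => osc_pos (by linarith [k.cast_nonneg (α := ℝ)])) hpos
    (fun k => by rw [grow]; push_cast; ring_nf) (by
      refine Summable.of_nonneg_of_le (fun k => (one_div_pos.2 (mul_pos (hpos _) (hpos _))).le)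
        (fun k => ?_) (summable_inv_grow_sq.add hs1)
      have h1 := hpos k
      have h2 := hpos (k + 1)
      have e : 1 / (grow k * grow (k + 1)) = (1 / grow k) * (1 / grow (k + 1)) := by
        rw [one_div_mul_one_div]
      rw [e, ← one_div_pow, ← one_div_pow]
      nlinarith [sq_nonneg (1 / grow k - 1 / grow (k + 1)), sq_nonneg (1 / grow k),
        sq_nonneg (1 / grow (k + 1))])
  refine ⟨fun k => (-1) ^ (k / 2) * z k, fun k => mul_ne_zero (by positivity) (hz0 k).ne', ?_, ?_⟩
  · refine Summable.of_nonneg_of_le (fun k => sq_nonneg _) (fun k => ?_) hs1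
    rw [mul_pow, ← pow_mul, mul_comm (k / 2), pow_mul]
    norm_num
    rw [← inv_pow, ← one_div]
    exact pow_le_pow_left₀ (hz0 k).le (hzb k) 2
  · intro a b k
    rw [pot_eq_osc a b (by omega)]
    have h := hzr k
    have hd : (k + 2) / 2 = k / 2 + 1 := by omega
    have hsgn : (-1 : ℝ) ^ (k + 3) * (-1) ^ ((k + 1) / 2) = - (-1) ^ (k / 2) := by
      rcases Nat.even_or_odd' k with ⟨m, rfl | rfl⟩
      · rw [show (2 * m + 1) / 2 = m by omega, show 2 * m / 2 = m by omega,
          show 2 * m + 3 = 2 * (m + 1) + 1 by ring, pow_succ, pow_mul]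
        norm_num
      · rw [show (2 * m + 1 + 1) / 2 = m + 1 by omega, show (2 * m + 1) / 2 = m by omega,
          show 2 * m + 1 + 3 = 2 * (m + 2) by ring, pow_mul]
        norm_num
        ring
    simp only [hd]
    push_cast at h ⊢
    rw [show (k : ℝ) + 1 + 2 = k + 3 by ring] at h
    rw [h]
    linear_combination osc ((k : ℝ) + 3) * z (k + 1) * hsgn

theorem exists_l2_solution (a b : ℝ) : ∃ u : ℕ → ℝ, u ≠ 0 ∧
    (∀ n : ℕ, 1 ≤ n → u (n + 1) + u (n - 1) + pot a b n * u n = 0 * u n) ∧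
    Summable fun n => u n ^ 2 := by
  obtain ⟨v, hv0, hvs, hv⟩ := exists_l2_tail
  let u1 := -v 1 - b * v 0
  let u : ℕ → ℝ
    | 0 => -v 0 - a * u1
    | 1 => u1
    | k + 2 => v k
  refine ⟨u, fun h => hv0 0 (congrFun h 2), fun n hn => ?_, (summable_nat_add_iff 2).1 hvs⟩
  match n, hn with
  | 1, _ => simp [u, pot]; ring
  | 2, _ => simp [u, u1, pot]; ring
  | k + 3, _ => simpa using hv a b k

/-- For a suitable value `V(1) = a` the square-summable solution satisfies the Dirichlet
condition. -/
theorem exists_zero_eigenvalue : ∃ a : ℝ,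
    Module.End.HasEigenvalue (opPot a 0 : HalfLine →ₗ[ℂ] HalfLine) 0 := by
  obtain ⟨v, hv0, hvs, hv⟩ := exists_l2_tail
  let u : ℕ → ℂ
    | 0 => ((-v 1 : ℝ) : ℂ)
    | k + 1 => (v k : ℂ)
  have hu : Memℓp u 2 := by
    rw [memlp_iff]
    refine (summable_nat_add_iff 1).1 ?_
    simpa [u] using hvs
  refine ⟨v 0 / v 1, ?_⟩
  refine Module.End.hasEigenvalue_of_hasEigenvector (x := (⟨u, hu⟩ : HalfLine)) ?_
  rw [Module.End.hasEigenvector_iff, Module.End.mem_eigenspace_iff]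
  constructor
  · ext k
    rw [zero_smul]
    change expr _ u k = 0
    match k with
    | 0 =>
      have : (v 1 : ℂ) ≠ 0 := by exact_mod_cast hv0 1
      simp [expr, u, pot]
      field_simp
      ring
    | 1 => simp [expr, u, pot]
    | k + 2 =>
      have := hv (v 0 / v 1) 0 k
      simp only [expr, u]
      exact_mod_cast this
  · intro h
    have h1 := congrArg (fun w : HalfLine => w 1) h
    have h2 : (v 0 : ℂ) = 0 := h1
    exact hv0 0 (by exact_mod_cast h2)

/-! ### Operator theory of the half-line operator -/


section General

variable {X : Type*} [NormedAddCommGroup X] [InnerProductSpace ℂ X] [CompleteSpace X]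

/-- A point of the spectrum of a compact perturbation of `A` that lies in the resolvent set of `A`
is an eigenvalue. -/
theorem hasEigenvalue_of_compact_perturbation {A K T : X →L[ℂ] X} (hT : T = A + K)
    (hK : IsCompactOperator K) {x : ℂ} (hx : x ∈ resolventSet ℂ A) (hxT : x ∈ spectrum ℂ T) :
    Module.End.HasEigenvalue (T : X →ₗ[ℂ] X) x := by
  obtain ⟨U, hU⟩ := spectrum.mem_resolventSet_iff.1 hx
  set R : X →L[ℂ] X := ↑U⁻¹ with hR
  have hRK : IsCompactOperator (R * K) := hK.clm_comp R
  rcases hRK.hasEigenvalue_or_mem_resolventSet (one_ne_zero (α := ℂ)) with h | h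
  · obtain ⟨w, hw⟩ := h.exists_hasEigenvector
    refine Module.End.hasEigenvalue_of_hasEigenvector (x := w) ?_
    rw [Module.End.hasEigenvector_iff, Module.End.mem_eigenspace_iff] at hw ⊢
    refine ⟨?_, hw.2⟩
    have h1 : R (K w) = w := by simpa using hw.1
    have h2 : (U : X →L[ℂ] X) (R (K w)) = K w := by
      change ((U : X →L[ℂ] X) * R) (K w) = K w
      rw [hR, Units.mul_inv]
      rfl
    rw [h1, hU] at h2
    have h3 : x • w - A w = K w := by simpa [Algebra.algebraMap_eq_smul_one] using h2
    change T w = x • w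
    rw [hT]
    change A w + K w = x • w
    rw [← h3]
    abel
  · exfalso
    rw [spectrum.mem_resolventSet_iff, map_one] at h
    refine hxT ?_
    rw [spectrum.mem_resolventSet_iff]
    have : algebraMap ℂ (X →L[ℂ] X) x - T = U * (1 - R * K) := by
      rw [mul_sub, ← mul_assoc, hR, Units.mul_inv, hU, hT]
      noncomm_ring
    rw [this]
    exact U.isUnit.mul h

/-- The quadratic form of a self-adjoint operator is bounded above by `c` exactly if the spectrum
is. -/
theorem form_le_iff_spectrum_le {T : X →L[ℂ] X} (hT : IsSelfAdjoint T) (c : ℝ) :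
    (∀ u, (inner ℂ u (T u)).re ≤ c * ‖u‖ ^ 2) ↔ ∀ x ∈ spectrum ℝ T, x ≤ c := by
  rw [← le_algebraMap_iff_spectrum_le (a := T) (r := c), ContinuousLinearMap.le_def,
    ContinuousLinearMap.isPositive_def']
  have hc : IsSelfAdjoint (algebraMap ℝ (X →L[ℂ] X) c) := (IsSelfAdjoint.all c).algebraMap _
  have key : ∀ u, (algebraMap ℝ (X →L[ℂ] X) c - T).reApplyInnerSelf u =
      c * ‖u‖ ^ 2 - (inner ℂ u (T u)).re := by
    intro u
    rw [ContinuousLinearMap.reApplyInnerSelf_apply]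
    have h1 : (algebraMap ℝ (X →L[ℂ] X) c - T) u = (c : ℂ) • u - T u := by
      simp [Algebra.algebraMap_eq_smul_one]
    rw [h1, inner_sub_left, inner_smul_left, inner_self_eq_norm_sq_to_K, map_sub,
      inner_re_symm (T u) u]
    congr 1
    simp [← Complex.ofReal_pow]
  constructor
  · intro h
    exact ⟨hc.sub hT, fun u => by rw [key]; linarith [h u]⟩
  · intro h u
    have := h.2 u
    rw [key] at this
    linarith

theorem le_form_iff_le_spectrum {T : X →L[ℂ] X} (hT : IsSelfAdjoint T) (c : ℝ) :
    (∀ u, c * ‖u‖ ^ 2 ≤ (inner ℂ u (T u)).re) ↔ ∀ x ∈ spectrum ℝ T, c ≤ x := by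
  have h := form_le_iff_spectrum_le hT.neg (-c)
  have h1 : (∀ u, (inner ℂ u ((-T) u)).re ≤ -c * ‖u‖ ^ 2) ↔
      ∀ u, c * ‖u‖ ^ 2 ≤ (inner ℂ u (T u)).re := by
    refine forall_congr' fun u => ?_
    rw [neg_apply, inner_neg_right, Complex.neg_re]
    constructor <;> intro h <;> linarith
  rw [← h1, h]
  rw [← spectrum.neg_eq]
  constructor
  · intro h x hx
    have := h (-x) (by simpa using hx)
    linarith
  · intro h x hx
    have := h (-x) (by simpa using hx)
    linarith

end General

theorem summable_mul_of_summable_sq {f g : ℕ → ℂ} (hf : Summable fun k => ‖f k‖ ^ 2)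
    (hg : Summable fun k => ‖g k‖ ^ 2) : Summable fun k => f k * g k := by
  refine Summable.of_norm_bounded (hf.add hg) fun k => ?_
  rw [norm_mul]
  nlinarith [sq_nonneg (‖f k‖ - ‖g k‖), sq_nonneg ‖f k‖, sq_nonneg ‖g k‖]

theorem summable_norm_sq (u : HalfLine) : Summable fun k => ‖u k‖ ^ 2 :=
  (memlp_iff _).1 (lp.memℓp u)

theorem hasSum_norm_sq (u : HalfLine) : HasSum (fun k => ‖u k‖ ^ 2) (‖u‖ ^ 2) := by
  have := lp.hasSum_norm (p := 2) (by norm_num) u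
  norm_num at this
  exact this

/-- The sesquilinear form of `H`, symmetric in the two neighbouring sites. -/
theorem hasSum_inner_opH (V : ℕ → ℝ) (hV : ∃ M, ∀ n, |V n| ≤ M) (u v : HalfLine) :
    HasSum (fun k => (starRingEnd ℂ) (u k) * v (k + 1) + (starRingEnd ℂ) (u (k + 1)) * v k +
      (V (k + 1) : ℂ) * ((starRingEnd ℂ) (u k) * v k)) (inner ℂ u (opH V hV v)) := by
  have hu : Summable fun k => ‖(starRingEnd ℂ) (u k)‖ ^ 2 := by
    simpa only [RCLike.norm_conj] using summable_norm_sq u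
  have hv := summable_norm_sq v
  have s1 : Summable fun k => (starRingEnd ℂ) (u k) * v (k + 1) :=
    summable_mul_of_summable_sq hu ((summable_nat_add_iff 1).2 hv)
  have s2 : Summable fun k => (starRingEnd ℂ) (u (k + 1)) * v k :=
    summable_mul_of_summable_sq (f := fun k => (starRingEnd ℂ) (u (k + 1)))
      ((summable_nat_add_iff 1).2 hu) hv
  have h2 : HasSum (fun k => (starRingEnd ℂ) (u k) * (if k = 0 then 0 else v (k - 1)))
      (∑' k, (starRingEnd ℂ) (u (k + 1)) * v k) := by
    refine (hasSum_nat_add_iff' 1).1 ?_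
    simpa using s2.hasSum
  have h := lp.hasSum_inner (𝕜 := ℂ) u (opH V hV v)
  have h3 : HasSum (fun k => (V (k + 1) : ℂ) * ((starRingEnd ℂ) (u k) * v k))
      (inner ℂ u (opH V hV v) - (∑' k, (starRingEnd ℂ) (u k) * v (k + 1)) -
        (∑' k, (starRingEnd ℂ) (u (k + 1)) * v k)) := by
    have e : (fun k => (V (k + 1) : ℂ) * ((starRingEnd ℂ) (u k) * v k)) = fun k =>
        inner ℂ (u k) (opH V hV v k) - (starRingEnd ℂ) (u k) * v (k + 1) -
          (starRingEnd ℂ) (u k) * (if k = 0 then 0 else v (k - 1)) := by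
      funext k
      rw [opH_apply, expr_eq]
      simp only [RCLike.inner_apply]
      ring
    rw [e]
    exact (h.sub s1.hasSum).sub h2
  convert (s1.hasSum.add s2.hasSum).add h3 using 1
  ring

theorem isSelfAdjoint_opH (V : ℕ → ℝ) (hV : ∃ M, ∀ n, |V n| ≤ M) : IsSelfAdjoint (opH V hV) := by
  rw [ContinuousLinearMap.isSelfAdjoint_iff_isSymmetric]
  intro u v
  change inner ℂ (opH V hV u) v = inner ℂ u (opH V hV v)
  have h1 := hasSum_inner_opH V hV u v
  have h2 := (hasSum_inner_opH V hV v u).star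
  rw [← inner_conj_symm]
  refine h2.unique ?_
  convert h1 using 2 with k
  simp
  ring

/-- The summand of the quadratic form of `H` at the index `k`, for a real sequence. -/
def formTerm (V : ℕ → ℝ) (f : ℕ → ℝ) (k : ℕ) : ℝ := 2 * f k * f (k + 1) + V (k + 1) * f k ^ 2

theorem hasSum_form (V : ℕ → ℝ) (hV : ∃ M, ∀ n, |V n| ≤ M) (u : HalfLine) :
    HasSum (fun k => formTerm V (fun j => (u j).re) k + formTerm V (fun j => (u j).im) k)
      (inner ℂ u (opH V hV u)).re := by
  convert Complex.hasSum_re (hasSum_inner_opH V hV u u) using 2 with k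
  simp [formTerm]
  ring

theorem abs_form_le (V : ℕ → ℝ) (hV : ∃ M, ∀ n, |V n| ≤ M) {q : ℝ} (hq : ∀ n, 1 ≤ n → |V n| ≤ q)
    (u : HalfLine) : |(inner ℂ u (opH V hV u)).re| ≤ (2 + q) * ‖u‖ ^ 2 := by
  have h := hasSum_form V hV u
  have hn := hasSum_norm_sq u
  have hs := hn.summable
  have hs1 := (summable_nat_add_iff 1).2 hs
  have hb : HasSum (fun k => ‖u k‖ ^ 2 + ‖u (k + 1)‖ ^ 2 + q * ‖u k‖ ^ 2)
      (‖u‖ ^ 2 + (∑' k, ‖u (k + 1)‖ ^ 2) + q * ‖u‖ ^ 2) := (hn.add hs1.hasSum).add (hn.mul_left q)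
  have hle : (∑' k, ‖u (k + 1)‖ ^ 2) ≤ ‖u‖ ^ 2 := by
    rw [← hn.tsum_eq, hs.tsum_eq_zero_add]
    nlinarith [sq_nonneg ‖u 0‖]
  have hterm : ∀ k, |formTerm V (fun j => (u j).re) k + formTerm V (fun j => (u j).im) k| ≤
      ‖u k‖ ^ 2 + ‖u (k + 1)‖ ^ 2 + q * ‖u k‖ ^ 2 := by
    intro k
    have e : ∀ j, ‖u j‖ ^ 2 = (u j).re ^ 2 + (u j).im ^ 2 := by
      intro j
      rw [Complex.sq_norm, Complex.normSq_apply]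
      ring
    rw [e, e]
    have h1 := abs_le.1 (hq (k + 1) (by omega))
    have h2 : 0 ≤ (u k).re ^ 2 + (u k).im ^ 2 := by positivity
    simp only [formTerm]
    rw [abs_le]
    constructor <;>
    nlinarith [sq_nonneg ((u k).re - (u (k + 1)).re), sq_nonneg ((u k).im - (u (k + 1)).im),
      sq_nonneg ((u k).re + (u (k + 1)).re), sq_nonneg ((u k).im + (u (k + 1)).im),
      mul_le_mul_of_nonneg_right h1.1 h2, mul_le_mul_of_nonneg_right h1.2 h2]
  rw [abs_le]
  constructor
  · have := hasSum_le (fun k => (abs_le.1 (hterm k)).1) hb.neg h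
    linarith
  · have := hasSum_le (fun k => (abs_le.1 (hterm k)).2) h hb
    linarith

theorem abs_le_of_mem_spectrum (V : ℕ → ℝ) (hV : ∃ M, ∀ n, |V n| ≤ M) {q : ℝ}
    (hq : ∀ n, 1 ≤ n → |V n| ≤ q) {x : ℝ} (hx : x ∈ spectrum ℝ (opH V hV)) : |x| ≤ 2 + q := by
  rw [abs_le]
  constructor
  · refine (le_form_iff_le_spectrum (isSelfAdjoint_opH V hV) _).1 (fun u => ?_) x hx
    have := (abs_le.1 (abs_form_le V hV hq u)).1
    linarith
  · exact (form_le_iff_spectrum_le (isSelfAdjoint_opH V hV) _).1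
      (fun u => (abs_le.1 (abs_form_le V hV hq u)).2) x hx

theorem zero_bounded : ∃ M : ℝ, ∀ n, |(0 : ℕ → ℝ) n| ≤ M := ⟨0, by simp⟩

/-- The free operator has no spectrum outside `[-2, 2]`. -/
theorem mem_resolventSet_free {x : ℝ} (hx : x ∉ Set.Icc (-2 : ℝ) 2) :
    (x : ℂ) ∈ resolventSet ℂ (opH 0 zero_bounded) := by
  by_contra h
  have h1 : x ∈ spectrum ℝ (opH 0 zero_bounded) := by
    rw [← spectrum.algebraMap_mem_iff ℂ]
    exact h
  have := abs_le_of_mem_spectrum 0 zero_bounded (q := 0) (by simp) h1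
  exact hx (abs_le.1 (by simpa using this))

theorem norm_le_of_coord_le {u w : HalfLine} {c : ℝ} (hc : 0 ≤ c) (h : ∀ k, ‖w k‖ ≤ c * ‖u k‖) :
    ‖w‖ ≤ c * ‖u‖ := by
  have h1 : ‖w‖ ^ 2 ≤ (c * ‖u‖) ^ 2 := by
    rw [mul_pow]
    refine hasSum_le (fun k => ?_) (hasSum_norm_sq w) ((hasSum_norm_sq u).mul_left (c ^ 2))
    rw [← mul_pow]
    exact pow_le_pow_left₀ (norm_nonneg _) (h k) 2
  exact le_of_sq_le_sq h1 (by positivity)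

/-- Multiplication by a potential that tends to `0` is a compact operator. -/
theorem isCompactOperator_potential (V : ℕ → ℝ) (hV : ∃ M, ∀ n, |V n| ≤ M)
    (h0 : Tendsto V atTop (𝓝 0)) :
    IsCompactOperator (opH V hV - opH 0 zero_bounded : HalfLine →L[ℂ] HalfLine) := by
  set K := opH V hV - opH 0 zero_bounded with hK
  have hKa : ∀ u k, K u k = (V (k + 1) : ℂ) * u k := by
    intro u k
    rw [hK, sub_apply, lp.coeFn_sub, Pi.sub_apply, opH_apply, opH_apply,
      expr_eq, expr_eq]
    simp
  -- the truncations of the potential have finite rank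
  let P : ℕ → (HalfLine →L[ℂ] HalfLine) := fun N =>
    ∑ k ∈ Finset.range N, (lp.singleContinuousLinearMap ℂ (fun _ : ℕ => ℂ) 2 k).comp
      ((V (k + 1) : ℂ) • (lp.evalCLM ℂ (fun _ : ℕ => ℂ) 2 k))
  have hPa : ∀ N u k, P N u k = if k < N then (V (k + 1) : ℂ) * u k else 0 := by
    intro N u k
    simp only [P, sum_apply, lp.coeFn_sum, Finset.sum_apply]
    have : ∀ j, ((lp.singleContinuousLinearMap ℂ (fun _ : ℕ => ℂ) 2 j).comp
      ((V (j + 1) : ℂ) • (lp.evalCLM ℂ (fun _ : ℕ => ℂ) 2 j))) u k =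
        if k = j then (V (j + 1) : ℂ) * u j else 0 := by
      intro j
      change lp.single (E := fun _ : ℕ => ℂ) 2 j ((V (j + 1) : ℂ) * u j) k = _
      rw [lp.single_apply]
      split_ifs with h
      · subst h; exact Pi.single_eq_same _ _
      · exact Pi.single_eq_of_ne h _
    simp only [this, Finset.sum_ite_eq, Finset.mem_range]
  have hPc : ∀ N, IsCompactOperator (P N) := by
    intro N
    refine Submodule.sum_mem (compactOperator (RingHom.id ℂ) HalfLine HalfLine) fun k _ => ?_
    exact (isCompactOperator_of_locallyCompactSpace_rng
      (lp.singleContinuousLinearMap ℂ (fun _ : ℕ => ℂ) 2 k)).comp_clm _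
  have hlim : Tendsto P atTop (𝓝 K) := by
    rw [tendsto_iff_norm_sub_tendsto_zero]
    rw [Metric.tendsto_atTop]
    intro ε hε
    obtain ⟨N, hN⟩ := Metric.tendsto_atTop.1 h0 (ε / 2) (by positivity)
    refine ⟨N, fun n hn => ?_⟩
    rw [Real.dist_0_eq_abs, abs_norm]
    refine lt_of_le_of_lt (ContinuousLinearMap.opNorm_le_bound _ (half_pos hε).le fun u => ?_)
      (half_lt_self hε)
    refine norm_le_of_coord_le (half_pos hε).le fun k => ?_
    rw [sub_apply, lp.coeFn_sub, Pi.sub_apply, hKa, hPa]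
    split_ifs with h
    · simp; positivity
    · rw [zero_sub, norm_neg, norm_mul]
      refine mul_le_mul_of_nonneg_right ?_ (norm_nonneg _)
      have := hN (k + 1) (by omega)
      rw [Real.dist_0_eq_abs] at this
      rw [Complex.norm_real, Real.norm_eq_abs]
      exact this.le
  exact isClosed_setOfPred_isCompactOperator.mem_of_tendsto hlim (Eventually.of_forall hPc)

/-- Outside `[-2, 2]` the spectrum of a half-line operator with a potential that tends to `0`
consists of eigenvalues. -/
theorem hasEigenvalue_of_mem_spectrum (V : ℕ → ℝ) (hV : ∃ M, ∀ n, |V n| ≤ M)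
    (h0 : Tendsto V atTop (𝓝 0)) {x : ℝ} (hx : x ∉ Set.Icc (-2 : ℝ) 2)
    (hs : (x : ℂ) ∈ spectrum ℂ (opH V hV)) :
    Module.End.HasEigenvalue (opH V hV : HalfLine →ₗ[ℂ] HalfLine) x :=
  hasEigenvalue_of_compact_perturbation (add_sub_cancel _ _).symm
    (isCompactOperator_potential V hV h0) (mem_resolventSet_free hx) hs

/-- A solution of the eigenvalue equation on the half line is determined by its first entry. -/
theorem eq_zero_of_eigen {V : ℕ → ℝ} {u : ℕ → ℂ} {x : ℂ} (h : ∀ k, expr V u k = x * u k)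
    (h0 : u 0 = 0) (k : ℕ) : u k = 0 := by
  induction k using Nat.twoStepInduction with
  | zero => exact h0
  | one =>
    have := h 0
    simpa [expr, h0] using this
  | more k h1 h2 =>
    have := h (k + 1)
    simpa [expr, h1, h2] using this

theorem finrank_eigenspace_eq_one (V : ℕ → ℝ) (hV : ∃ M, ∀ n, |V n| ≤ M) {x : ℂ}
    (hx : Module.End.HasEigenvalue (opH V hV : HalfLine →ₗ[ℂ] HalfLine) x) :
    Module.finrank ℂ (Module.End.eigenspace (opH V hV : HalfLine →ₗ[ℂ] HalfLine) x) = 1 := by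
  obtain ⟨w, hw⟩ := hx.exists_hasEigenvector
  have hexpr : ∀ {u : HalfLine}, u ∈ Module.End.eigenspace (opH V hV : HalfLine →ₗ[ℂ] HalfLine) x →
      ∀ k, expr V u k = x * u k := by
    intro u hu k
    rw [Module.End.mem_eigenspace_iff] at hu
    have : opH V hV u k = (x • u : HalfLine) k := congrArg (fun v : HalfLine => v k) hu
    simpa [opH_apply] using this
  have hw0 : w 0 ≠ 0 := by
    intro h
    refine hw.2 ?_
    ext k
    exact eq_zero_of_eigen (hexpr hw.1) h k
  refine finrank_eq_one (⟨w, hw.1⟩ : Module.End.eigenspace _ x) ?_ ?_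
  · intro h
    exact hw.2 (congrArg Subtype.val h)
  · rintro ⟨v, hv⟩
    refine ⟨v 0 / w 0, ?_⟩
    have hm := Submodule.sub_mem _ (Submodule.smul_mem _ (v 0 / w 0) hw.1) hv
    refine Subtype.ext ?_
    change (v 0 / w 0) • w = v
    rw [← sub_eq_zero]
    ext k
    refine eq_zero_of_eigen (hexpr hm) ?_ k
    rw [lp.coeFn_sub, lp.coeFn_smul, Pi.sub_apply, Pi.smul_apply, smul_eq_mul,
      div_mul_cancel₀ _ hw0, sub_self]

/-- The interval `[-2, 2]` belongs to the spectrum: plane waves cut off to a long window far out are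
approximate eigenvectors. -/
theorem mem_spectrum_of_mem_Icc (V : ℕ → ℝ) (hV : ∃ M, ∀ n, |V n| ≤ M)
    (h0 : Tendsto V atTop (𝓝 0)) {x : ℝ} (hx : x ∈ Set.Icc (-2 : ℝ) 2) :
    (x : ℂ) ∈ spectrum ℂ (opH V hV) := by
  by_contra hres
  obtain ⟨U, hU⟩ := spectrum.mem_resolventSet_iff.1 (not_not.1 hres : (x : ℂ) ∈ resolventSet ℂ _)
  set H := opH V hV
  -- `x - H` is bounded below
  obtain ⟨C, hC, hb⟩ : ∃ C : ℝ, 0 < C ∧ ∀ u : HalfLine, ‖u‖ ≤ C * ‖(x : ℂ) • u - H u‖ := by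
    refine ⟨‖(↑U⁻¹ : HalfLine →L[ℂ] HalfLine)‖ + 1, by positivity, fun u => ?_⟩
    have h1 : (↑U⁻¹ : HalfLine →L[ℂ] HalfLine) ((x : ℂ) • u - H u) = u := by
      have : ((↑U⁻¹ : HalfLine →L[ℂ] HalfLine) * (U : HalfLine →L[ℂ] HalfLine)) u = u := by
        rw [Units.inv_mul]; rfl
      rw [hU, Algebra.algebraMap_eq_smul_one] at this
      exact this
    calc ‖u‖ = ‖(↑U⁻¹ : HalfLine →L[ℂ] HalfLine) ((x : ℂ) • u - H u)‖ := by rw [h1]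
      _ ≤ ‖(↑U⁻¹ : HalfLine →L[ℂ] HalfLine)‖ * ‖(x : ℂ) • u - H u‖ :=
        ContinuousLinearMap.le_opNorm _ _
      _ ≤ _ := by
        refine mul_le_mul_of_nonneg_right ?_ (norm_nonneg _)
        linarith
  set ε : ℝ := 1 / (2 * C + 1) with hε
  have hεpos : 0 < ε := by positivity
  have hε1 : ε ≤ 1 := by
    rw [hε, div_le_one (by positivity)]; linarith
  obtain ⟨N, hN⟩ := Metric.tendsto_atTop.1 h0 ε hεpos
  obtain ⟨L, hL⟩ := exists_nat_gt (256 * C ^ 2)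
  -- the phase `z` solves the free equation at energy `x`
  set z : ℂ := Complex.exp (Complex.I * (Real.arccos (x / 2) : ℝ)) with hz
  have hznorm : ‖z‖ = 1 := by
    rw [hz, mul_comm, Complex.norm_exp_ofReal_mul_I]
  have hz0 : z ≠ 0 := by
    intro h; rw [h] at hznorm; simp at hznorm
  have hzx : z + z⁻¹ = x := by
    have h1 : Complex.cos ((Real.arccos (x / 2) : ℝ) : ℂ) = (x / 2 : ℝ) := by
      rw [← Complex.ofReal_cos, Real.cos_arccos (by linarith [hx.1]) (by linarith [hx.2])]
    rw [Complex.cos] at h1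
    rw [hz, ← Complex.exp_neg]
    push_cast at h1
    rw [mul_comm Complex.I, ← neg_mul]
    linear_combination 2 * h1
  set M := N + 1 with hM
  let f : ℕ → ℂ := fun k => if M ≤ k ∧ k < M + L then z ^ k else 0
  have hfn : ∀ k, ‖f k‖ = if k ∈ Finset.Ico M (M + L) then 1 else 0 := by
    intro k
    simp only [f, Finset.mem_Ico]
    split_ifs <;> simp [hznorm]
  have hfle : ∀ k, ‖f k‖ ≤ 1 := by
    intro k
    rw [hfn]
    split_ifs <;> norm_num
  have hfsq : HasSum (fun k => ‖f k‖ ^ 2) L := by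
    have h := hasSum_sum_of_ne_finset_zero (L := SummationFilter.unconditional ℕ)
      (f := fun k => ‖f k‖ ^ 2) (s := Finset.Ico M (M + L))
      (fun k hk => by rw [hfn, if_neg hk]; norm_num)
    convert h using 1
    rw [Finset.sum_congr rfl fun k hk => by rw [hfn, if_pos hk]]
    simp
  let u : HalfLine := ⟨f, (memlp_iff f).2 hfsq.summable⟩
  have hu : ‖u‖ ^ 2 = L := (hasSum_norm_sq u).unique hfsq
  let F : Finset ℕ := {N, M, N + L, M + L}
  have hfree : ∀ k, k ∉ F → (x : ℂ) * f k - f (k + 1) - (if k = 0 then 0 else f (k - 1)) = 0 := by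
    intro k hk
    simp only [F, Finset.mem_insert, Finset.mem_singleton, not_or] at hk
    by_cases h1 : M ≤ k ∧ k < M + L
    · have e0 : f k = z ^ k := if_pos h1
      have e1 : f (k + 1) = z ^ (k + 1) := if_pos (by omega)
      have e2 : f (k - 1) = z ^ (k - 1) := if_pos (by omega)
      obtain ⟨j, rfl⟩ : ∃ j, k = j + 1 := ⟨k - 1, by omega⟩
      rw [e0, e1, e2, if_neg (by omega), ← hzx, Nat.add_sub_cancel]
      field_simp
      ring
    · have e0 : f k = 0 := if_neg h1
      have e1 : f (k + 1) = 0 := if_neg (by omega)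
      have e2 : (if k = 0 then 0 else f (k - 1)) = 0 := by
        split_ifs
        · rfl
        · exact if_neg (by omega)
      rw [e0, e1, e2]
      simp
  have hfree4 : ∀ k, ‖(x : ℂ) * f k - f (k + 1) - (if k = 0 then 0 else f (k - 1))‖ ≤ 4 := by
    intro k
    have h1 : ‖(x : ℂ) * f k‖ ≤ 2 := by
      rw [norm_mul, Complex.norm_real, Real.norm_eq_abs]
      have := abs_le.2 hx
      nlinarith [hfle k, norm_nonneg (f k), abs_nonneg x]
    have h2 : ‖(if k = 0 then 0 else f (k - 1))‖ ≤ 1 := by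
      split_ifs
      · simp
      · exact hfle _
    calc _ ≤ ‖(x : ℂ) * f k - f (k + 1)‖ + ‖(if k = 0 then 0 else f (k - 1))‖ := norm_sub_le _ _
      _ ≤ ‖(x : ℂ) * f k‖ + ‖f (k + 1)‖ + ‖(if k = 0 then 0 else f (k - 1))‖ := by
        gcongr
        exact norm_sub_le _ _
      _ ≤ 2 + 1 + 1 := add_le_add (add_le_add h1 (hfle _)) h2
      _ = 4 := by norm_num
  have hpt : ∀ k, ‖((x : ℂ) • u - H u) k‖ ^ 2 ≤
      (if k ∈ F then 32 else 0) + 2 * ε ^ 2 * ‖f k‖ ^ 2 := by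
    intro k
    have e : ((x : ℂ) • u - H u) k =
        ((x : ℂ) * f k - f (k + 1) - (if k = 0 then 0 else f (k - 1))) - (V (k + 1) : ℂ) * f k := by
      rw [lp.coeFn_sub, lp.coeFn_smul, Pi.sub_apply, Pi.smul_apply, smul_eq_mul, opH_apply,
        expr_eq]
      change (x : ℂ) * f k - (f (k + 1) + (if k = 0 then 0 else f (k - 1)) + (V (k + 1) : ℂ) * f k)
        = _
      ring
    have hVk : ‖(V (k + 1) : ℂ) * f k‖ ≤ ε * ‖f k‖ := by
      rw [norm_mul]
      by_cases hk : k ∈ Finset.Ico M (M + L)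
      · refine mul_le_mul_of_nonneg_right ?_ (norm_nonneg _)
        have := hN (k + 1) (by rw [Finset.mem_Ico] at hk; omega)
        rw [Real.dist_0_eq_abs] at this
        rw [Complex.norm_real, Real.norm_eq_abs]
        exact this.le
      · rw [hfn, if_neg hk]
        simp
    set A := (x : ℂ) * f k - f (k + 1) - (if k = 0 then 0 else f (k - 1)) with hA
    have hA2 : 2 * ‖A‖ ^ 2 ≤ if k ∈ F then 32 else 0 := by
      split_ifs with hk
      · nlinarith [hfree4 k, norm_nonneg A]
      · rw [hA, hfree k hk]; simp
    rw [e]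
    have h1 := norm_sub_le A ((V (k + 1) : ℂ) * f k)
    have h2 : ‖A - (V (k + 1) : ℂ) * f k‖ ≤ ‖A‖ + ε * ‖f k‖ := by linarith
    have h3 := pow_le_pow_left₀ (norm_nonneg _) h2 2
    nlinarith [sq_nonneg (‖A‖ - ε * ‖f k‖)]
  have hsumF : HasSum (fun k => if k ∈ F then (32 : ℝ) else 0) (32 * F.card) := by
    have h := hasSum_sum_of_ne_finset_zero (L := SummationFilter.unconditional ℕ)
      (f := fun k => if k ∈ F then (32 : ℝ) else 0) (s := F)
      (fun k hk => if_neg hk)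
    convert h using 1
    rw [Finset.sum_congr rfl fun k hk => if_pos hk]
    simp [mul_comm]
  have hw : ‖(x : ℂ) • u - H u‖ ^ 2 ≤ 32 * F.card + 2 * ε ^ 2 * L :=
    hasSum_le hpt (hasSum_norm_sq _) (hsumF.add (hfsq.mul_left (2 * ε ^ 2)))
  have hF : (F.card : ℝ) ≤ 4 := by exact_mod_cast Finset.card_le_four
  have h1 : (L : ℝ) ≤ C ^ 2 * (128 + 2 * ε ^ 2 * L) := by
    rw [← hu]
    calc ‖u‖ ^ 2 ≤ (C * ‖(x : ℂ) • u - H u‖) ^ 2 := pow_le_pow_left₀ (norm_nonneg _) (hb u) 2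
      _ = C ^ 2 * ‖(x : ℂ) • u - H u‖ ^ 2 := by ring
      _ ≤ C ^ 2 * (128 + 2 * ε ^ 2 * ‖u‖ ^ 2) := by
        rw [hu]
        refine mul_le_mul_of_nonneg_left ?_ (sq_nonneg _)
        linarith
  have h2 : C * ε ≤ 1 / 2 := by
    rw [hε, mul_one_div, div_le_div_iff₀ (by positivity) (by norm_num)]
    linarith
  have h3 : (C * ε) ^ 2 ≤ (1 / 2) ^ 2 := pow_le_pow_left₀ (by positivity) h2 2
  have hL0 : (0 : ℝ) ≤ L := L.cast_nonneg
  nlinarith [mul_le_mul_of_nonneg_right h3 hL0]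

/-! ### The ground state transform -/

/-- If `x ^ a ζ(ln x)` is differentiated, the result is of the same shape. -/
theorem hasDerivAt_rpow_mul_comp_log {a x ζ' : ℝ} {ζ : ℝ → ℝ} (hx : 0 < x)
    (hζ : HasDerivAt ζ ζ' (Real.log x)) :
    HasDerivAt (fun y => y ^ a * ζ (Real.log y)) (x ^ (a - 1) * (a * ζ (Real.log x) + ζ')) x := by
  have h := (Real.hasDerivAt_rpow_const (p := a) (Or.inl hx.ne')).mul
    (hζ.comp x (Real.hasDerivAt_log hx.ne'))
  refine h.congr_deriv ?_
  rw [Real.rpow_sub_one hx.ne']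
  simp only [Function.comp]
  field_simp

/-- A second difference is a value of the second derivative. -/
theorem exists_second_difference_eq {f f' f'' : ℝ → ℝ} {x : ℝ}
    (h1 : ∀ y ∈ Set.Icc (x - 1) (x + 1), HasDerivAt f (f' y) y)
    (h2 : ∀ y ∈ Set.Icc (x - 1) (x + 1), HasDerivAt f' (f'' y) y) :
    ∃ y ∈ Set.Icc (x - 1) (x + 1), f (x + 1) + f (x - 1) - 2 * f x = f'' y := by
  have d1 : ∀ y ∈ Set.Icc (x - 1) x, HasDerivAt (fun y => f (y + 1) - f y) (f' (y + 1) - f' y) y := by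
    intro y hy
    have h := (h1 (y + 1) ⟨by linarith [hy.1], by linarith [hy.2]⟩).comp_add_const y 1
    exact h.sub (h1 y ⟨hy.1, by linarith [hy.2]⟩)
  obtain ⟨ξ, hξ, e1⟩ := exists_hasDerivAt_eq_slope (fun y => f (y + 1) - f y)
    (fun y => f' (y + 1) - f' y) (show x - 1 < x by linarith)
    (fun y hy => (d1 y hy).continuousAt.continuousWithinAt) (fun y hy => d1 y ⟨hy.1.le, hy.2.le⟩)
  obtain ⟨η, hη, e2⟩ := exists_hasDerivAt_eq_slope f' f'' (show ξ < ξ + 1 by linarith)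
    (fun y hy => (h2 y ⟨by linarith [hy.1, hξ.1], by linarith [hy.2, hξ.2]⟩).continuousAt.continuousWithinAt)
    (fun y hy => h2 y ⟨by linarith [hy.1, hξ.1], by linarith [hy.2, hξ.2]⟩)
  refine ⟨η, ⟨by linarith [hη.1, hξ.1], by linarith [hη.2, hξ.2]⟩, ?_⟩
  rw [e2, show ξ + 1 - ξ = 1 by ring, div_one, e1, show x - (x - 1) = 1 by ring, div_one,
    show x - 1 + 1 = x by ring]
  ring

theorem sqrt_mul_osc_eq {x : ℝ} (hx : 0 < x) :
    √x * osc x = x ^ (-(1 / 2) : ℝ) * (1 + 2 / Real.log x) := by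
  rw [Real.rpow_neg hx.le, ← Real.sqrt_eq_rpow, osc, ← mul_assoc]
  congr 1
  rw [mul_one_div, Real.sqrt_div_self', one_div]

/-- The second difference of `√x W(x)` is of the order `x ^ (-5/2)`. -/
theorem abs_second_difference_sqrt_mul_osc_le {x : ℝ} (hx : 4 ≤ x) :
    √x * |√(x + 1) * osc (x + 1) + √(x - 1) * osc (x - 1) - 2 * (√x * osc x)| ≤ 64 / x ^ 2 := by
  have hζ1 : ∀ l : ℝ, l ≠ 0 → HasDerivAt (fun l => 1 + 2 / l) (-2 / l ^ 2) l := by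
    intro l hl
    refine (((hasDerivAt_const l (2 : ℝ)).div (hasDerivAt_id l) hl).const_add 1).congr_deriv ?_
    simp
  have hζ2 : ∀ l : ℝ, l ≠ 0 → HasDerivAt (fun l => -(1 / 2) * (1 + 2 / l) + -2 / l ^ 2)
      (-(1 / 2) * (-2 / l ^ 2) + 4 / l ^ 3) l := by
    intro l hl
    have h := ((hasDerivAt_const l (-2 : ℝ)).div (hasDerivAt_pow 2 l) (pow_ne_zero 2 hl))
    refine (((hζ1 l hl).const_mul (-(1 / 2))).add h).congr_deriv ?_
    field_simp
    ring
  have hlog : ∀ y ∈ Set.Icc (x - 1) (x + 1), 0 < y ∧ 1 ≤ Real.log y := by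
    intro y hy
    have h3 : 3 ≤ y := by linarith [hy.1]
    refine ⟨by linarith, ?_⟩
    rw [Real.le_log_iff_exp_le (by linarith)]
    linarith [Real.exp_one_lt_d9]
  obtain ⟨y, hy, e⟩ := exists_second_difference_eq (x := x)
    (f := fun y => y ^ (-(1 / 2) : ℝ) * (1 + 2 / Real.log y))
    (f' := fun y => y ^ (-(1 / 2) - 1 : ℝ) *
      (-(1 / 2) * (1 + 2 / Real.log y) + -2 / Real.log y ^ 2))
    (f'' := fun y => y ^ (-(1 / 2) - 1 - 1 : ℝ) *
      ((-(1 / 2) - 1) * (-(1 / 2) * (1 + 2 / Real.log y) + -2 / Real.log y ^ 2) +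
        (-(1 / 2) * (-2 / Real.log y ^ 2) + 4 / Real.log y ^ 3)))
    (fun y hy => hasDerivAt_rpow_mul_comp_log (hlog y hy).1
      (hζ1 _ (by linarith [(hlog y hy).2])))
    (fun y hy => hasDerivAt_rpow_mul_comp_log (hlog y hy).1
      (ζ := fun l => -(1 / 2) * (1 + 2 / l) + -2 / l ^ 2) (hζ2 _ (by linarith [(hlog y hy).2])))
  rw [sqrt_mul_osc_eq (by linarith), sqrt_mul_osc_eq (by linarith), sqrt_mul_osc_eq (by linarith)]
  rw [e]
  obtain ⟨hy0, hl⟩ := hlog y hy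
  have hinv : 1 / Real.log y ≤ 1 := by rw [div_le_one (by linarith)]; exact hl
  have hinv0 : 0 < 1 / Real.log y := by positivity
  set t := 1 / Real.log y with ht
  have hfac : |(-(1 / 2) - 1) * (-(1 / 2) * (1 + 2 / Real.log y) + -2 / Real.log y ^ 2) +
        (-(1 / 2) * (-2 / Real.log y ^ 2) + 4 / Real.log y ^ 3)| ≤ 11 := by
    have e1 : (-(1 / 2) - 1) * (-(1 / 2) * (1 + 2 / Real.log y) + -2 / Real.log y ^ 2) +
        (-(1 / 2) * (-2 / Real.log y ^ 2) + 4 / Real.log y ^ 3) =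
        3 / 4 + 3 / 2 * t + 4 * t ^ 2 + 4 * t ^ 3 := by
      rw [ht]
      field_simp
      ring
    rw [e1, abs_of_nonneg (by positivity)]
    have h2 : t ^ 2 ≤ 1 := pow_le_one₀ hinv0.le hinv
    have h3 : t ^ 3 ≤ 1 := pow_le_one₀ hinv0.le hinv
    linarith
  rw [abs_mul, abs_of_nonneg (by positivity)]
  have hpow : y ^ (-(1 / 2) - 1 - 1 : ℝ) ≤ 1 / (√(x / 2) * (x / 2) ^ 2) := by
    have h1 : y ^ (-(1 / 2) - 1 - 1 : ℝ) = 1 / (√y * y ^ 2) := by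
      rw [Real.sqrt_eq_rpow, ← Real.rpow_natCast y 2, ← Real.rpow_add hy0, one_div (y ^ _),
        ← Real.rpow_neg hy0.le]
      norm_num
    rw [h1]
    have h2 : x / 2 ≤ y := by linarith [hy.1]
    refine one_div_le_one_div_of_le (mul_pos (Real.sqrt_pos.2 (by linarith)) (by positivity)) ?_
    exact mul_le_mul (Real.sqrt_le_sqrt h2) (pow_le_pow_left₀ (by linarith) h2 2) (by positivity)
      (by positivity)
  have hx0 : 0 < x := by linarith
  have hs2 : √x ≤ 10 / 7 * √(x / 2) := by
    rw [show (10 : ℝ) / 7 * √(x / 2) = √((10 / 7) ^ 2 * (x / 2)) by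
      rw [Real.sqrt_mul (by positivity), Real.sqrt_sq (by norm_num)]]
    exact Real.sqrt_le_sqrt (by linarith)
  have hs0 : 0 < √(x / 2) := Real.sqrt_pos.2 (by linarith)
  calc √x * (y ^ (-(1 / 2) - 1 - 1 : ℝ) * _) ≤
      (10 / 7 * √(x / 2)) * (1 / (√(x / 2) * (x / 2) ^ 2) * 11) := by
        refine mul_le_mul hs2 (mul_le_mul hpow hfac (abs_nonneg _) (by positivity))
          (by positivity) (by positivity)
    _ = (440 / 7) / x ^ 2 := by
        field_simp
        ring
    _ ≤ 64 / x ^ 2 := by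
        refine div_le_div_of_nonneg_right (by norm_num) (by positivity)

theorem sqrt_second_difference {x : ℝ} (hx : 2 ≤ x) :
    -(1 / (4 * x)) - 1 / (2 * x ^ 3) ≤ √x * (√(x + 1) + √(x - 1) - 2 * √x) ∧
      √x * (√(x + 1) + √(x - 1) - 2 * √x) ≤ -(1 / (4 * x)) := by
  have hx0 : 0 < x := by linarith
  set e := 1 / x with he
  have he0 : 0 < e := by positivity
  have he1 : e ≤ 1 / 2 := one_div_le_one_div_of_le (by norm_num) hx
  have e1 : √(x + 1) = √x * √(1 + e) := by
    rw [← Real.sqrt_mul hx0.le]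
    congr 1
    rw [he]
    field_simp
  have e2 : √(x - 1) = √x * √(1 - e) := by
    rw [← Real.sqrt_mul hx0.le]
    congr 1
    rw [he]
    field_simp
  set a := √(1 + e) with ha
  set b := √(1 - e) with hb
  have ha2 : a ^ 2 = 1 + e := Real.sq_sqrt (by linarith)
  have hb2 : b ^ 2 = 1 - e := Real.sq_sqrt (by linarith)
  have ha0 : 0 ≤ a := Real.sqrt_nonneg _
  have hb0 : 0 ≤ b := Real.sqrt_nonneg _
  have hab2 : (a * b) ^ 2 = 1 - e ^ 2 := by rw [mul_pow, ha2, hb2]; ring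
  have hab0 : 0 ≤ a * b := mul_nonneg ha0 hb0
  set p := e ^ 2 with hp
  have hp0 : 0 ≤ p := sq_nonneg e
  have hp1 : p ≤ 1 / 4 := by nlinarith
  have hpp : p ^ 2 ≤ 1 / 16 := by nlinarith
  have u1 : a * b ≤ 1 - p / 2 := by
    refine le_of_sq_le_sq ?_ (by linarith)
    rw [hab2]
    linarith [sq_nonneg p]
  have u2 : 1 - p / 2 - p ^ 2 / 2 ≤ a * b := by
    refine le_of_sq_le_sq ?_ hab0
    rw [hab2]
    have := mul_nonneg (sq_nonneg p) (show 0 ≤ 3 / 4 - p / 2 - p ^ 2 / 4 by linarith)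
    linarith
  have hab : (a + b) ^ 2 = 2 + 2 * (a * b) := by
    linear_combination ha2 + hb2
  have v1 : a + b ≤ 2 - p / 4 := by
    refine le_of_sq_le_sq ?_ (by linarith)
    rw [hab]
    linarith [sq_nonneg p]
  have v2 : 2 - p / 4 - p ^ 2 / 2 ≤ a + b := by
    refine le_of_sq_le_sq ?_ (add_nonneg ha0 hb0)
    rw [hab]
    have := mul_nonneg (sq_nonneg p) (show 0 ≤ 15 / 16 - p / 4 - p ^ 2 / 4 by linarith)
    linarith
  have e3 : √x * (√(x + 1) + √(x - 1) - 2 * √x) = x * (a + b - 2) := by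
    rw [e1, e2]
    have : √x ^ 2 = x := Real.sq_sqrt hx0.le
    linear_combination (a + b - 2) * this
  have e4 : 1 / (4 * x) = x * (p / 4) := by
    rw [hp, he]; field_simp
  have e5 : 1 / (2 * x ^ 3) = x * (p ^ 2 / 2) := by
    rw [hp, he]; field_simp
  rw [e3, e4, e5]
  constructor
  · have := mul_le_mul_of_nonneg_left v2 hx0.le
    linarith
  · have := mul_le_mul_of_nonneg_left v1 hx0.le
    linarith

/-- The sign `τ (-1)ⁿ` of the oscillating potential; the value `τ = -1` describes the edge `-2`. -/
def altSign (τ : ℝ) (n : ℕ) : ℝ := τ * (-1) ^ n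

/-- An approximate solution at the edge energy `2`, in which the factor in brackets absorbs the
oscillation of the potential. -/
noncomputable def groundState (τ : ℝ) (n : ℕ) : ℝ := √n * (1 + altSign τ n * osc n / 4)

/-- The effective potential left over by the ground state transform. -/
noncomputable def effPot (τ : ℝ) (n : ℕ) : ℝ :=
  groundState τ n * (groundState τ (n + 1) + groundState τ (n - 1) +
    (altSign τ n * osc n - 2) * groundState τ n)

theorem altSign_succ (τ : ℝ) (n : ℕ) : altSign τ (n + 1) = -altSign τ n := by
  unfold altSign
  ring

theorem altSign_sq {τ : ℝ} (hτ : τ ^ 2 = 1) (n : ℕ) : altSign τ n ^ 2 = 1 := by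
  unfold altSign
  rw [mul_pow, hτ, ← pow_mul, mul_comm n, pow_mul]
  norm_num

/-- The effective potential in terms of second differences: the first-order effect of the oscillating
potential has cancelled, and its second-order effect is `n W(n)² / 4`. -/
theorem effPot_eq {τ : ℝ} (hτ : τ ^ 2 = 1) {n : ℕ} (hn1 : 1 ≤ n) :
    effPot τ n = (1 + altSign τ n * osc n / 4) *
      (√(n : ℝ) * (√((n : ℝ) + 1) + √((n : ℝ) - 1) - 2 * √(n : ℝ)) + (n : ℝ) * osc n ^ 2 / 4 -
        altSign τ n / 4 * (√(n : ℝ) * (√((n : ℝ) + 1) * osc ((n : ℝ) + 1) +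
          √((n : ℝ) - 1) * osc ((n : ℝ) - 1) - 2 * (√(n : ℝ) * osc n)))) := by
  have hs2 : altSign τ n ^ 2 = 1 := altSign_sq hτ n
  have hsx2 : √(n : ℝ) ^ 2 = n := Real.sq_sqrt n.cast_nonneg
  have h1 : groundState τ (n + 1) =
      √((n : ℝ) + 1) * (1 - altSign τ n * osc ((n : ℝ) + 1) / 4) := by
    unfold groundState
    rw [altSign_succ]
    push_cast
    ring
  have h2 : groundState τ (n - 1) =
      √((n : ℝ) - 1) * (1 - altSign τ n * osc ((n : ℝ) - 1) / 4) := by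
    unfold groundState
    obtain ⟨m, rfl⟩ : ∃ m, n = m + 1 := ⟨n - 1, by omega⟩
    rw [altSign_succ, Nat.add_sub_cancel, Nat.cast_add, Nat.cast_one, add_sub_cancel_right]
    ring
  rw [effPot, h1, h2, groundState]
  generalize altSign τ n = s at *
  generalize √(n : ℝ) = r at *
  linear_combination (1 + s * osc n / 4) * osc n * r ^ 2 * osc n / 4 * hs2 +
    (1 + s * osc n / 4) * osc n ^ 2 / 4 * hsx2

theorem error_terms_le {x l : ℝ} (hl : 8 ≤ l) (hx : 200 * l ≤ x) :
    1 / (x * l ^ 2) ≤ 1 / (x * l) / 8 ∧ 16 / x ^ 2 ≤ 1 / (x * l) / 10 ∧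
      1 / (2 * x ^ 3) ≤ 1 / (x * l) / 100 := by
  have hl0 : 0 < l := by linarith
  have hx0 : 0 < x := by linarith
  refine ⟨?_, ?_, ?_⟩
  · rw [div_div]
    refine one_div_le_one_div_of_le (by positivity) ?_
    nlinarith [mul_pos hx0 hl0]
  · rw [div_div, div_le_div_iff₀ (by positivity) (by positivity)]
    nlinarith [mul_pos hx0 hl0]
  · rw [div_div, div_le_div_iff₀ (by positivity) (by positivity)]
    have h2 : 0 ≤ x * (2 * x ^ 2 - 100 * l) := mul_nonneg hx0.le (by nlinarith)
    linarith

/-- Far out the weights of the transformed form are comparable to `n`, and the effective potential to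
`1 / (n ln n)`. -/
theorem groundState_estimates {τ : ℝ} (hτ : τ ^ 2 = 1) {n : ℕ} (hl : 8 ≤ Real.log n)
    (hn : 200 * Real.log n ≤ n) :
    (n : ℝ) / 2 ≤ groundState τ n ^ 2 ∧ 0 < groundState τ n ∧ groundState τ n ≤ 9 / 8 * √n ∧
      7 / 8 * √n ≤ groundState τ n ∧
      1 / (2 * (n * Real.log n)) ≤ effPot τ n ∧ effPot τ n ≤ 2 / (n * Real.log n) := by
  set x : ℝ := (n : ℝ) with hx
  set l := Real.log x with hldef
  have hx1600 : 1600 ≤ x := by linarith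
  have hx0 : 0 < x := by linarith
  have hl0 : 0 < l := by linarith
  have hn1 : 1 ≤ n := by
    have : (1 : ℝ) ≤ n := by linarith
    exact_mod_cast this
  set s := altSign τ n with hs
  have hs2 : s ^ 2 = 1 := altSign_sq hτ n
  have hs1 := abs_le.1 ((sq_le_one_iff_abs_le_one s).1 hs2.le)
  have hsx : 0 < √x := Real.sqrt_pos.2 hx0
  have hsx2 : √x ^ 2 = x := Real.sq_sqrt hx0.le
  have hW0 : 0 < osc x := osc_pos (by linarith)
  have hW1 : osc x ≤ 1 / 8 := by
    unfold osc
    have h1 : 1 / x ≤ 1 / 1600 := one_div_le_one_div_of_le (by norm_num) hx1600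
    have h2 : 2 / Real.log x ≤ 1 := by rw [div_le_one hl0]; linarith
    have h3 : 0 < 1 / x := by positivity
    have h4 : 0 < 2 / Real.log x := by positivity
    nlinarith
  set q := 1 + s * osc x / 4 with hq
  have hq1 : 7 / 8 ≤ q := by nlinarith
  have hq2 : q ≤ 9 / 8 := by nlinarith
  have hg : groundState τ n = √x * q := rfl
  set D := √(x + 1) + √(x - 1) - 2 * √x with hD
  set E := √(x + 1) * osc (x + 1) + √(x - 1) * osc (x - 1) - 2 * (√x * osc x) with hE
  have hρ : effPot τ n = q * (√x * D + x * osc x ^ 2 / 4 - s / 4 * (√x * E)) :=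
    effPot_eq hτ hn1
  obtain ⟨hD1, hD2⟩ := sqrt_second_difference (x := x) (by linarith)
  have hE1 := abs_second_difference_sqrt_mul_osc_le (x := x) (by linarith)
  rw [← hE] at hE1
  replace hE1 : |√x * E| ≤ 64 / x ^ 2 := by rwa [abs_mul, abs_of_pos hsx]
  obtain ⟨hE2, hE3⟩ := abs_le.1 hE1
  have hosc : x * osc x ^ 2 / 4 = 1 / (4 * x) + 1 / (x * l) + 1 / (x * l ^ 2) := by
    unfold osc
    rw [← hldef]
    field_simp
    ring
  set m := 1 / (x * l) with hm
  have hm0 : 0 < m := by positivity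
  have hm1' : 0 < 1 / (x * l ^ 2) := by positivity
  obtain ⟨hm1, hm2, hm3⟩ := error_terms_le hl hn
  rw [← hm] at hm1 hm2 hm3
  have hm4 : 64 / x ^ 2 = 4 * (16 / x ^ 2) := by ring
  rw [hm4] at hE2 hE3
  have hsE : |s / 4 * (√x * E)| ≤ 16 / x ^ 2 := by
    rw [abs_mul, abs_div, show |s| = 1 by rw [← sq_eq_sq₀ (abs_nonneg s) zero_le_one, sq_abs, hs2, one_pow]]
    rw [abs_of_pos (show (0 : ℝ) < 4 by norm_num)]
    linarith only [hE1, hm4]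
  obtain ⟨hsE1, hsE2⟩ := abs_le.1 hsE
  set B := √x * D + x * osc x ^ 2 / 4 - s / 4 * (√x * E) with hB
  have hB1 : 7 / 8 * m ≤ B := by
    rw [hB, hosc]; linarith only [hm1, hm2, hm3, hm1', hsE1, hsE2, hD1, hD2, hm0]
  have hB2 : B ≤ 5 / 4 * m := by
    rw [hB, hosc]; linarith only [hm1, hm2, hm3, hm1', hsE1, hsE2, hD1, hD2, hm0]
  have hq0 : 1 / 2 ≤ q ^ 2 := by
    have := mul_le_mul hq1 hq1 (by norm_num) (by linarith)
    linarith
  have hqB1 : 7 / 8 * (7 / 8 * m) ≤ q * B := mul_le_mul hq1 hB1 (by linarith) (by linarith)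
  have hqB2 : q * B ≤ 9 / 8 * (5 / 4 * m) := mul_le_mul hq2 hB2 (by linarith) (by norm_num)
  rw [hg, hρ]
  refine ⟨?_, mul_pos hsx (by linarith), ?_, ?_, ?_, ?_⟩
  · rw [mul_pow, hsx2]
    have := mul_le_mul_of_nonneg_left hq0 hx0.le
    linarith
  · rw [mul_comm]
    exact mul_le_mul_of_nonneg_right hq2 hsx.le
  · rw [mul_comm]
    exact mul_le_mul_of_nonneg_left hq1 hsx.le
  · have : 1 / (2 * (x * l)) = m / 2 := by rw [hm]; field_simp
    rw [this]
    linarith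
  · have : 2 / (x * l) = 2 * m := by rw [hm]; field_simp
    rw [this]
    linarith

/-- The **ground state transform**: with `u = g y`, the quadratic form of the operator at the edge
energy becomes a form with the weights `effPot` and `g n * g (n + 1)`. Boundary terms are kept. -/
theorem sum_form_eq (g v y : ℕ → ℝ) (K : ℕ) :
    ∑ k ∈ Finset.range K, (2 * (g (k + 1) * y (k + 1)) * (g (k + 2) * y (k + 2)) +
        (v (k + 1) - 2) * (g (k + 1) * y (k + 1)) ^ 2) =
      ∑ k ∈ Finset.range K, (g (k + 1) * (g (k + 2) + g k + (v (k + 1) - 2) * g (k + 1)) *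
        y (k + 1) ^ 2 - g (k + 1) * g (k + 2) * (y (k + 2) - y (k + 1)) ^ 2) +
      g K * g (K + 1) * y (K + 1) ^ 2 - g 0 * g 1 * y 1 ^ 2 := by
  induction K with
  | zero => simp
  | succ K ih =>
    rw [Finset.sum_range_succ, ih, Finset.sum_range_succ]
    ring

/-! ### The form bound on a subspace of finite codimension -/

theorem exists_threshold : ∃ N : ℕ, ∀ n : ℕ, N ≤ n →
    8 ≤ Real.log n ∧ 200 * Real.log n ≤ n := by
  have h1 : ∀ᶠ x : ℝ in atTop, 8 ≤ Real.log x := Real.tendsto_log_atTop.eventually_ge_atTop 8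
  have h2 := Real.isLittleO_log_id_atTop.bound (show (0 : ℝ) < 1 / 200 by norm_num)
  have h3 : ∀ᶠ x : ℝ in atTop, 8 ≤ Real.log x ∧ 200 * Real.log x ≤ x := by
    filter_upwards [h1, h2, eventually_gt_atTop 0] with x hx1 hx2 hx3
    refine ⟨hx1, ?_⟩
    simp only [id, Real.norm_eq_abs] at hx2
    rw [abs_of_pos hx3] at hx2
    linarith [le_abs_self (Real.log x)]
  exact eventually_atTop.1 (tendsto_natCast_atTop_atTop.eventually h3)

theorem log_succ_sub_log_bounds {n : ℕ} (hn : 1 ≤ n) :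
    1 / (n : ℝ) ≤ 2 * (Real.log ((n + 1 : ℕ) : ℝ) - Real.log (n : ℝ)) ∧
      Real.log ((n + 1 : ℕ) : ℝ) - Real.log (n : ℝ) ≤ 1 / (n : ℝ) := by
  have hn2 : (1 : ℝ) ≤ n := by exact_mod_cast hn
  have h := Real.one_sub_inv_le_log_of_pos (x := ((n : ℝ) + 1) / n) (by positivity)
  have h' := Real.log_le_sub_one_of_pos (x := ((n : ℝ) + 1) / n) (by positivity)
  rw [Real.log_div (by positivity) (by positivity)] at h h'
  have e : 1 - (((n : ℝ) + 1) / n)⁻¹ = 1 / ((n : ℝ) + 1) := by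
    field_simp
    ring
  have e' : ((n : ℝ) + 1) / n - 1 = 1 / n := by
    field_simp
    ring
  rw [e] at h
  rw [e'] at h'
  have h2 : 1 / (n : ℝ) ≤ 2 * (1 / ((n : ℝ) + 1)) := by
    rw [mul_one_div, div_le_div_iff₀ (by positivity) (by positivity)]
    linarith
  push_cast
  exact ⟨by linarith, h'⟩

theorem sum_inv_le {A B : ℕ} (hA : 1 ≤ A) (hAB : A ≤ B) :
    ∑ n ∈ Finset.Ico A B, 1 / (n : ℝ) ≤ 2 * (Real.log B - Real.log A) := by
  refine (Finset.sum_le_sum fun n hn =>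
    (log_succ_sub_log_bounds (hA.trans (Finset.mem_Ico.1 hn).1)).1).trans ?_
  rw [← Finset.mul_sum, Finset.sum_Ico_sub (fun n : ℕ => Real.log (n : ℝ)) hAB]

theorem le_sum_inv {A B : ℕ} (hA : 1 ≤ A) (hAB : A ≤ B) :
    Real.log B - Real.log A ≤ ∑ n ∈ Finset.Ico A B, 1 / (n : ℝ) := by
  rw [← Finset.sum_Ico_sub (fun n : ℕ => Real.log (n : ℝ)) hAB]
  exact Finset.sum_le_sum fun n hn =>
    (log_succ_sub_log_bounds (hA.trans (Finset.mem_Ico.1 hn).1)).2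

/-- A discrete weighted Poincaré inequality on a block `[A, B)`, for functions that vanish at the
left end: it holds as soon as the block is short on the logarithmic scale. -/
theorem block_inequality {ρ w y : ℕ → ℝ} {A B : ℕ} (hA : 2 ≤ A) (hAB : A ≤ B) (hyA : y A = 0)
    (hρ : ∀ n, A ≤ n → ρ n ≤ 2 / (n * Real.log n)) (hw : ∀ n, A ≤ n → (n : ℝ) / 2 ≤ w n)
    (hlog : 16 * (Real.log B - Real.log A) ^ 2 ≤ Real.log A) :
    ∑ n ∈ Finset.Ico A B, ρ n * y n ^ 2 ≤
      ∑ n ∈ Finset.Ico A B, w n * (y (n + 1) - y n) ^ 2 := by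
  have hA' : (2 : ℝ) ≤ A := by exact_mod_cast hA
  have hlA : 0 < Real.log A := Real.log_pos (by linarith)
  set H := ∑ n ∈ Finset.Ico A B, 1 / (n : ℝ) with hH
  set D := ∑ n ∈ Finset.Ico A B, (n : ℝ) * (y (n + 1) - y n) ^ 2 with hD
  have hH0 : 0 ≤ H := Finset.sum_nonneg fun n _ => by positivity
  have hD0 : 0 ≤ D := Finset.sum_nonneg fun n _ => by positivity
  have hHle : H ≤ 2 * (Real.log B - Real.log A) := sum_inv_le (by omega) hAB
  have hy : ∀ n ∈ Finset.Ico A B, y n ^ 2 ≤ D * H := by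
    intro n hn
    obtain ⟨hn1, hn2⟩ := Finset.mem_Ico.1 hn
    have hsub : Finset.Ico A n ⊆ Finset.Ico A B := Finset.Ico_subset_Ico_right hn2.le
    have e : y n = ∑ m ∈ Finset.Ico A n, (y (m + 1) - y m) := by
      rw [Finset.sum_Ico_sub y hn1, hyA, sub_zero]
    have hcs := Finset.sum_sq_le_sum_mul_sum_of_sq_le_mul (Finset.Ico A n)
      (r := fun m => y (m + 1) - y m) (f := fun m => (m : ℝ) * (y (m + 1) - y m) ^ 2)
      (g := fun m => 1 / (m : ℝ)) (fun m _ => by positivity) (fun m _ => by positivity)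
      (fun m hm => by
        have : (0 : ℝ) < m := by
          exact_mod_cast (by omega : 0 < 2).trans_le (hA.trans (Finset.mem_Ico.1 hm).1)
        refine le_of_eq ?_
        field_simp)
    rw [e]
    refine hcs.trans (mul_le_mul ?_ ?_ (Finset.sum_nonneg fun m _ => by positivity) hD0)
    · exact Finset.sum_le_sum_of_subset_of_nonneg hsub fun m _ _ => by positivity
    · exact Finset.sum_le_sum_of_subset_of_nonneg hsub fun m _ _ => by positivity
  have h1 : ∑ n ∈ Finset.Ico A B, ρ n * y n ^ 2 ≤
      ∑ n ∈ Finset.Ico A B, (2 / Real.log A * (D * H)) * (1 / (n : ℝ)) := by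
    refine Finset.sum_le_sum fun n hn => ?_
    have hAn := (Finset.mem_Ico.1 hn).1
    have hn2 : (A : ℝ) ≤ n := by exact_mod_cast hAn
    have h2 : ρ n ≤ 2 / Real.log A * (1 / (n : ℝ)) := by
      refine (hρ n hAn).trans ?_
      rw [div_mul_div_comm, mul_one, mul_comm]
      refine div_le_div_of_nonneg_left (by norm_num) (mul_pos hlA (by linarith)) ?_
      exact mul_le_mul_of_nonneg_right (Real.log_le_log (by linarith) hn2) (by linarith)
    calc ρ n * y n ^ 2 ≤ 2 / Real.log A * (1 / (n : ℝ)) * y n ^ 2 :=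
          mul_le_mul_of_nonneg_right h2 (sq_nonneg _)
      _ ≤ 2 / Real.log A * (1 / (n : ℝ)) * (D * H) :=
          mul_le_mul_of_nonneg_left (hy n hn) (by positivity)
      _ = _ := by ring
  rw [← Finset.mul_sum, ← hH] at h1
  have h2 : 1 / 2 * D ≤ ∑ n ∈ Finset.Ico A B, w n * (y (n + 1) - y n) ^ 2 := by
    rw [hD, Finset.mul_sum]
    refine Finset.sum_le_sum fun n hn => ?_
    rw [← mul_assoc]
    refine mul_le_mul_of_nonneg_right ?_ (sq_nonneg _)
    linarith [hw n (Finset.mem_Ico.1 hn).1]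
  have h3 : 4 * H ^ 2 ≤ Real.log A := by
    have := pow_le_pow_left₀ hH0 hHle 2
    linarith
  have h4 : 2 / Real.log A * (D * H) * H ≤ 1 / 2 * D := by
    have e : 2 / Real.log A * (D * H) * H = 1 / 2 * D * (4 * H ^ 2 / Real.log A) := by
      field_simp
      ring
    rw [e]
    refine mul_le_of_le_one_right (by positivity) ?_
    rwa [div_le_one hlA]
  linarith

/-- The sites at which a Dirichlet condition decouples the blocks. -/
noncomputable def cutSite (j : ℕ) : ℕ := ⌈Real.exp ((j : ℝ) ^ 2 / 100)⌉₊

theorem exp_le_cutSite (j : ℕ) : Real.exp ((j : ℝ) ^ 2 / 100) ≤ cutSite j := Nat.le_ceil _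

theorem cutSite_mono : Monotone cutSite := by
  intro i j hij
  refine Nat.ceil_mono (Real.exp_le_exp.2 ?_)
  have : (i : ℝ) ≤ j := by exact_mod_cast hij
  gcongr

/-- The cuts satisfy the smallness condition of `block_inequality`. -/
theorem log_cutSite_bounds {j : ℕ} (hj : 202 ≤ j) :
    16 * (Real.log (cutSite (j + 1)) - Real.log (cutSite j)) ^ 2 ≤ Real.log (cutSite j) := by
  have hj' : (202 : ℝ) ≤ j := by exact_mod_cast hj
  have hlow : ∀ i : ℕ, (i : ℝ) ^ 2 / 100 ≤ Real.log (cutSite i) := fun i => by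
    rw [Real.le_log_iff_exp_le ((Real.exp_pos _).trans_le (exp_le_cutSite i))]
    exact exp_le_cutSite i
  have hup : Real.log (cutSite (j + 1)) ≤ ((j + 1 : ℕ) : ℝ) ^ 2 / 100 + 1 := by
    have h0 : (1 : ℝ) ≤ Real.exp (((j + 1 : ℕ) : ℝ) ^ 2 / 100) := Real.one_le_exp (by positivity)
    rw [Real.log_le_iff_le_exp ((Real.exp_pos _).trans_le (exp_le_cutSite _)), Real.exp_add]
    have h1 := (Nat.ceil_lt_add_one (Real.exp_pos (((j + 1 : ℕ) : ℝ) ^ 2 / 100)).le).le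
    have h2 : (2 : ℝ) ≤ Real.exp 1 := by linarith [Real.add_one_le_exp 1]
    unfold cutSite
    nlinarith
  have hmono : Real.log (cutSite j) ≤ Real.log (cutSite (j + 1)) :=
    Real.log_le_log ((Real.exp_pos _).trans_le (exp_le_cutSite _))
      (by exact_mod_cast cutSite_mono (Nat.le_succ j))
  have hlj := hlow j
  push_cast at hup
  have hd : Real.log (cutSite (j + 1)) - Real.log (cutSite j) ≤ j / 40 := by
    nlinarith
  have := pow_le_pow_left₀ (sub_nonneg.2 hmono) hd 2
  nlinarith

theorem exists_first_cut : ∃ J : ℕ, 202 ≤ J ∧ ∀ n : ℕ, cutSite J ≤ n →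
    8 ≤ Real.log n ∧ 200 * Real.log n ≤ n := by
  obtain ⟨N, hN⟩ := exists_threshold
  refine ⟨max 202 (100 * N), le_max_left _ _, fun n hn => hN n (le_trans ?_ hn)⟩
  have h1 : ((100 * N : ℕ) : ℝ) ≤ (max 202 (100 * N) : ℕ) := by exact_mod_cast le_max_right _ _
  have h2 : ((202 : ℕ) : ℝ) ≤ (max 202 (100 * N) : ℕ) := by exact_mod_cast le_max_left _ _
  have h3 := exp_le_cutSite (max 202 (100 * N))
  have h4 := Real.add_one_le_exp (((max 202 (100 * N) : ℕ) : ℝ) ^ 2 / 100)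
  have h5 : (N : ℝ) ≤ cutSite (max 202 (100 * N)) := by
    push_cast at h1 h2 h3 h4 ⊢
    nlinarith
  exact_mod_cast h5

theorem weight_ge {τ : ℝ} (hτ : τ ^ 2 = 1) {n : ℕ} (hn : 8 ≤ Real.log n ∧ 200 * Real.log n ≤ n)
    (hn' : 8 ≤ Real.log (n + 1 : ℕ) ∧ 200 * Real.log (n + 1 : ℕ) ≤ (n + 1 : ℕ)) :
    (n : ℝ) / 2 ≤ groundState τ n * groundState τ (n + 1) := by
  obtain ⟨-, -, -, h1, -⟩ := groundState_estimates hτ hn.1 hn.2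
  obtain ⟨-, -, -, h2, -⟩ := groundState_estimates hτ hn'.1 hn'.2
  have h3 : √(n : ℝ) ≤ √((n + 1 : ℕ) : ℝ) := Real.sqrt_le_sqrt (by push_cast; linarith)
  have h4 := mul_le_mul h1 ((mul_le_mul_of_nonneg_left h3 (by norm_num)).trans h2)
    (by positivity) (by linarith [Real.sqrt_nonneg (n : ℝ)])
  have h5 : √(n : ℝ) * √n = n := Real.mul_self_sqrt n.cast_nonneg
  nlinarith [n.cast_nonneg (α := ℝ)]

theorem blocks_inequality {τ : ℝ} (hτ : τ ^ 2 = 1) {J : ℕ} (hJ : 202 ≤ J)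
    (hJ' : ∀ n : ℕ, cutSite J ≤ n → 8 ≤ Real.log n ∧ 200 * Real.log n ≤ n) {y : ℕ → ℝ} (i : ℕ)
    (hcut : ∀ j, J ≤ j → j ≤ J + i → y (cutSite j) = 0) :
    ∑ n ∈ Finset.Ico (cutSite J) (cutSite (J + i)), (effPot τ n * y n ^ 2 -
      groundState τ n * groundState τ (n + 1) * (y (n + 1) - y n) ^ 2) ≤ 0 := by
  induction i with
  | zero => simp
  | succ i ih =>
    have h1 : cutSite J ≤ cutSite (J + i) := cutSite_mono (by omega)
    have h2 : cutSite (J + i) ≤ cutSite (J + (i + 1)) := cutSite_mono (by omega)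
    rw [← Finset.sum_Ico_consecutive _ h1 h2]
    have h3 := ih fun j hj hj' => hcut j hj (by omega)
    have h4 := block_inequality (ρ := effPot τ) (y := y)
      (w := fun n => groundState τ n * groundState τ (n + 1)) (A := cutSite (J + i))
      (B := cutSite (J + (i + 1))) ?_ h2 (hcut _ (by omega) (by omega)) ?_ ?_
      (log_cutSite_bounds (show 202 ≤ J + i by omega))
    · rw [Finset.sum_sub_distrib (s := Finset.Ico (cutSite (J + i)) _)]
      linarith
    · have h := exp_le_cutSite (J + i)
      have h' := Real.add_one_le_exp (((J + i : ℕ) : ℝ) ^ 2 / 100)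
      have h'' : (202 : ℝ) ≤ (J + i : ℕ) := by exact_mod_cast (by omega : 202 ≤ J + i)
      have : ((2 : ℕ) : ℝ) ≤ cutSite (J + i) := by
        push_cast at h h' h'' ⊢
        nlinarith
      exact_mod_cast this
    · intro n hn
      have := hJ' n (h1.trans hn)
      exact (groundState_estimates hτ this.1 this.2).2.2.2.2.2
    · intro n hn
      exact weight_ge hτ (hJ' n (h1.trans hn)) (hJ' (n + 1) (by omega))

/-- The quadratic form near the edge `2`, for a real sequence `u` of the sites `n` that vanishes up
to the first cut and at the further cuts. The last term is a boundary term. -/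
theorem sum_form_le {τ : ℝ} (hτ : τ ^ 2 = 1) {J : ℕ} (hJ : 202 ≤ J)
    (hJ' : ∀ n : ℕ, cutSite J ≤ n → 8 ≤ Real.log n ∧ 200 * Real.log n ≤ n) {M K : ℕ} (hM : J ≤ M)
    (hK : cutSite M ≤ K) {u : ℕ → ℝ} (hu : ∀ n, n ≤ cutSite J → u n = 0)
    (hcut : ∀ j, J ≤ j → j ≤ M → u (cutSite j) = 0) :
    ∑ k ∈ Finset.range K, (2 * u (k + 1) * u (k + 2) +
        (altSign τ (k + 1) * osc (k + 1 : ℕ) - 2) * u (k + 1) ^ 2) ≤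
      4 * Real.exp (-((M : ℝ) ^ 2 / 50)) * ∑ k ∈ Finset.range K, u (k + 1) ^ 2 +
        2 * u (K + 1) ^ 2 := by
  set g := groundState τ with hg
  have hest := fun n (hn : cutSite J ≤ n) => groundState_estimates hτ (hJ' n hn).1 (hJ' n hn).2
  set y : ℕ → ℝ := fun n => u n / g n with hy
  have huy : ∀ n, u n = g n * y n := by
    intro n
    rcases le_total n (cutSite J) with h | h
    · simp [hy, hu n h]
    · simp only [hy]
      rw [mul_div_cancel₀ _ (hest n h).2.1.ne']
  have hy0 : ∀ n, n ≤ cutSite J → y n = 0 := fun n hn => by simp [hy, hu n hn]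
  have hJM := cutSite_mono hM
  have h1J : 1 ≤ cutSite J := by
    have := (Real.exp_pos _).trans_le (exp_le_cutSite J)
    exact_mod_cast this
  have hid := sum_form_eq g (fun n => altSign τ n * osc n) y K
  have e1 : ∀ k, 2 * u (k + 1) * u (k + 2) +
      (altSign τ (k + 1) * osc (k + 1 : ℕ) - 2) * u (k + 1) ^ 2 =
      2 * (g (k + 1) * y (k + 1)) * (g (k + 2) * y (k + 2)) +
        (altSign τ (k + 1) * osc (k + 1 : ℕ) - 2) * (g (k + 1) * y (k + 1)) ^ 2 := by
    intro k
    rw [← huy, ← huy]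
  rw [Finset.sum_congr rfl fun k _ => e1 k, hid]
  have e2 : ∑ k ∈ Finset.range K, (g (k + 1) * (g (k + 2) + g k +
        (altSign τ (k + 1) * osc (k + 1 : ℕ) - 2) * g (k + 1)) *
        y (k + 1) ^ 2 - g (k + 1) * g (k + 2) * (y (k + 2) - y (k + 1)) ^ 2) =
      ∑ n ∈ Finset.Ico 1 (K + 1), (effPot τ n * y n ^ 2 -
        g n * g (n + 1) * (y (n + 1) - y n) ^ 2) := by
    rw [Finset.sum_Ico_eq_sum_range]
    refine Finset.sum_congr rfl fun k _ => ?_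
    rw [add_comm 1 k]
    rfl
  have e3 : ∑ k ∈ Finset.range K, u (k + 1) ^ 2 = ∑ n ∈ Finset.Ico 1 (K + 1), u n ^ 2 := by
    rw [Finset.sum_Ico_eq_sum_range]
    refine Finset.sum_congr rfl fun k _ => ?_
    rw [add_comm 1 k]
  rw [e2, e3, ← Finset.sum_Ico_consecutive _ h1J (by omega : cutSite J ≤ K + 1),
    ← Finset.sum_Ico_consecutive _ hJM (by omega : cutSite M ≤ K + 1)]
  have s1 : ∑ n ∈ Finset.Ico 1 (cutSite J), (effPot τ n * y n ^ 2 -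
        g n * g (n + 1) * (y (n + 1) - y n) ^ 2) = 0 := by
    refine Finset.sum_eq_zero fun n hn => ?_
    have := (Finset.mem_Ico.1 hn).2
    rw [hy0 n (by omega), hy0 (n + 1) (by omega)]
    ring
  have s2 : ∑ n ∈ Finset.Ico (cutSite J) (cutSite M), (effPot τ n * y n ^ 2 -
        g n * g (n + 1) * (y (n + 1) - y n) ^ 2) ≤ 0 := by
    obtain ⟨i, rfl⟩ := Nat.exists_eq_add_of_le hM
    exact blocks_inequality hτ hJ hJ' i fun j h1 h2 => by simp [hy, hcut j h1 h2]
  have s3 : ∑ n ∈ Finset.Ico (cutSite M) (K + 1), (effPot τ n * y n ^ 2 -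
        g n * g (n + 1) * (y (n + 1) - y n) ^ 2) ≤
      ∑ n ∈ Finset.Ico (cutSite M) (K + 1), 4 * Real.exp (-((M : ℝ) ^ 2 / 50)) * u n ^ 2 := by
    refine Finset.sum_le_sum fun n hn => ?_
    have hMn := (Finset.mem_Ico.1 hn).1
    have hn1 := hest n (hJM.trans hMn)
    have hn2 := hest (n + 1) (by omega)
    have hl := (hJ' n (hJM.trans hMn)).1
    have hn0 : (0 : ℝ) < n := by
      have := (Real.exp_pos _).trans_le (exp_le_cutSite M)
      have h' : (cutSite M : ℝ) ≤ n := by exact_mod_cast hMn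
      linarith
    have hpos : 0 ≤ g n * g (n + 1) * (y (n + 1) - y n) ^ 2 :=
      mul_nonneg (mul_pos hn1.2.1 hn2.2.1).le (sq_nonneg _)
    have hρ : effPot τ n ≤ 2 / n := by
      refine hn1.2.2.2.2.2.trans ?_
      refine div_le_div_of_nonneg_left (by norm_num) hn0 ?_
      nlinarith
    have hexp : 1 ≤ Real.exp (-((M : ℝ) ^ 2 / 50)) * (n : ℝ) ^ 2 := by
      have h' : Real.exp ((M : ℝ) ^ 2 / 100) ≤ n :=
        (exp_le_cutSite M).trans (by exact_mod_cast hMn)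
      have h2 := pow_le_pow_left₀ (Real.exp_pos _).le h' 2
      rw [← Real.exp_nat_mul] at h2
      calc (1 : ℝ) = Real.exp (-((M : ℝ) ^ 2 / 50)) * Real.exp ((2 : ℕ) * ((M : ℝ) ^ 2 / 100)) := by
            rw [← Real.exp_add, ← Real.exp_zero]
            congr 1
            push_cast
            ring
        _ ≤ _ := mul_le_mul_of_nonneg_left h2 (Real.exp_pos _).le
    have h2 : 2 / (n : ℝ) ≤ 4 * Real.exp (-((M : ℝ) ^ 2 / 50)) * g n ^ 2 := by
      calc 2 / (n : ℝ) ≤ 2 / n * (Real.exp (-((M : ℝ) ^ 2 / 50)) * (n : ℝ) ^ 2) :=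
            le_mul_of_one_le_right (by positivity) hexp
        _ = 4 * Real.exp (-((M : ℝ) ^ 2 / 50)) * ((n : ℝ) / 2) := by
            field_simp
            ring
        _ ≤ _ := mul_le_mul_of_nonneg_left hn1.1 (by positivity)
    rw [huy n, mul_pow, ← mul_assoc]
    have := mul_le_mul_of_nonneg_right (hρ.trans h2) (sq_nonneg (y n))
    linarith
  have s4 : ∑ n ∈ Finset.Ico (cutSite M) (K + 1), 4 * Real.exp (-((M : ℝ) ^ 2 / 50)) * u n ^ 2 ≤
      4 * Real.exp (-((M : ℝ) ^ 2 / 50)) * ∑ n ∈ Finset.Ico 1 (K + 1), u n ^ 2 := by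
    rw [← Finset.mul_sum]
    refine mul_le_mul_of_nonneg_left ?_ (by positivity)
    exact Finset.sum_le_sum_of_subset_of_nonneg
      (Finset.Ico_subset_Ico_left (h1J.trans hJM)) fun _ _ _ => sq_nonneg _
  have s5 : g K * g (K + 1) * y (K + 1) ^ 2 ≤ 2 * u (K + 1) ^ 2 := by
    have hK1 := hest K (by omega)
    have hK2 := hest (K + 1) (by omega)
    have h3 : √(K : ℝ) ≤ √((K + 1 : ℕ) : ℝ) := Real.sqrt_le_sqrt (by push_cast; linarith)
    have h4 : g K ≤ 2 * g (K + 1) := by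
      have := Real.sqrt_nonneg (K : ℝ)
      linarith [hK1.2.2.1, hK2.2.2.2.1]
    rw [huy (K + 1), mul_pow]
    have := mul_le_mul_of_nonneg_right h4 (mul_nonneg hK2.2.1.le (sq_nonneg (y (K + 1))))
    linarith
  have s6 : g 0 * g 1 * y 1 ^ 2 = 0 := by
    rw [hy0 1 h1J]
    ring
  linarith

/-! ### Counting eigenvalues outside the interval -/

theorem pot_succ_mul_eq (a b τ : ℝ) {f : ℕ → ℝ} (hf : ∀ k, k < 2 → f k = 0) (k : ℕ) :
    τ * pot a b (k + 1) * f k ^ 2 = altSign τ (k + 1) * osc (k + 1 : ℕ) * f k ^ 2 := by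
  by_cases hk : k < 2
  · simp [hf k hk]
  · rw [pot_eq_osc a b (by omega), altSign]
    ring

/-- The sign change `u k ↦ (-1) ^ k u k` turns the form of `-H` into the one with potential `-V`. -/
theorem hasSum_form_scaled (V : ℕ → ℝ) (hV : ∃ M, ∀ n, |V n| ≤ M) (u : HalfLine) {τ : ℝ}
    (hτ : τ ^ 2 = 1) :
    HasSum (fun k => formTerm (fun n => τ * V n) (fun j => (τ ^ j) * (u j).re) k +
        formTerm (fun n => τ * V n) (fun j => (τ ^ j) * (u j).im) k)
      (τ * (inner ℂ u (opH V hV u)).re) := by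
  have h := (hasSum_form V hV u).mul_left τ
  have e : (fun k => τ * (formTerm V (fun j => (u j).re) k + formTerm V (fun j => (u j).im) k)) =
      fun k => formTerm (fun n => τ * V n) (fun j => (τ ^ j) * (u j).re) k +
        formTerm (fun n => τ * V n) (fun j => (τ ^ j) * (u j).im) k := by
    funext k
    have hk : (τ ^ k) ^ 2 = 1 := by rw [← pow_mul, mul_comm, pow_mul, hτ, one_pow]
    simp only [formTerm, pow_succ]
    linear_combination (-(2 * τ * ((u k).re * (u (k + 1)).re + (u k).im * (u (k + 1)).im)) -
      τ * V (k + 1) * ((u k).re ^ 2 + (u k).im ^ 2)) * hk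
  rwa [e] at h

/-- The form bound: on vectors that vanish up to the first cut and at the further cuts, the
operator exceeds the edges `±2` by an exponentially small amount only. The sign `τ` selects the
edge. -/
theorem form_le_of_cuts {a b τ : ℝ} (hτ : τ ^ 2 = 1) {J : ℕ} (hJ : 202 ≤ J)
    (hJ' : ∀ n : ℕ, cutSite J ≤ n → 8 ≤ Real.log n ∧ 200 * Real.log n ≤ n) {M : ℕ} (hM : J ≤ M)
    {u : HalfLine} (hu : ∀ k, k < cutSite J → u k = 0)
    (hcut : ∀ j, J ≤ j → j ≤ M → u (cutSite j - 1) = 0) :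
    τ * (inner ℂ u (opPot a b u)).re ≤
      (2 + 4 * Real.exp (-((M : ℝ) ^ 2 / 50))) * ‖u‖ ^ 2 := by
  have h3J : 3 ≤ cutSite J := by
    have h := exp_le_cutSite J
    have h' := Real.add_one_le_exp ((J : ℝ) ^ 2 / 100)
    have h'' : (202 : ℝ) ≤ J := by exact_mod_cast hJ
    have : ((3 : ℕ) : ℝ) ≤ cutSite J := by
      push_cast
      nlinarith
    exact_mod_cast this
  set δ := 4 * Real.exp (-((M : ℝ) ^ 2 / 50)) with hδ
  -- the partial sums of the form of a real sequence
  have key : ∀ f : ℕ → ℝ, (∀ k, k < cutSite J → f k = 0) →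
      (∀ j, J ≤ j → j ≤ M → f (cutSite j - 1) = 0) → ∀ K, cutSite M ≤ K →
      ∑ k ∈ Finset.range K, formTerm (fun n => τ * pot a b n) f k ≤
        (2 + δ) * ∑ k ∈ Finset.range K, f k ^ 2 + 2 * f K ^ 2 := by
    intro f hf hfc K hK
    have h := sum_form_le hτ hJ hJ' hM hK (u := fun n => if n = 0 then 0 else f (n - 1))
      (fun n hn => by
        split_ifs with h0
        · rfl
        · exact hf _ (by omega))
      (fun j h1 h2 => by
        split_ifs with h0
        · rfl
        · exact hfc j h1 h2)
    simp only [Nat.add_one_ne_zero, if_false, Nat.add_sub_cancel] at h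
    have e : ∑ k ∈ Finset.range K, formTerm (fun n => τ * pot a b n) f k =
        ∑ k ∈ Finset.range K, (2 * f k * f (k + 1) +
          (altSign τ (k + 1) * osc (k + 1 : ℕ) - 2) * f k ^ 2) +
          2 * ∑ k ∈ Finset.range K, f k ^ 2 := by
      rw [Finset.mul_sum, ← Finset.sum_add_distrib]
      refine Finset.sum_congr rfl fun k _ => ?_
      have := pot_succ_mul_eq a b τ (f := f) (fun k hk => hf k (by omega)) k
      simp only [formTerm]
      rw [this]
      ring
    rw [e]
    have h' : ∑ k ∈ Finset.range K, (2 * f k * f (k + 1) +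
          (altSign τ (k + 1) * osc (k + 1 : ℕ) - 2) * f k ^ 2) ≤
        δ * ∑ k ∈ Finset.range K, f k ^ 2 + 2 * f K ^ 2 := h
    linarith
  have hform := (hasSum_form_scaled (pot a b) (pot_bounded a b) u hτ).tendsto_sum_nat
  have hn := (hasSum_norm_sq u)
  have hn0 : Tendsto (fun K => ‖u K‖ ^ 2) atTop (𝓝 0) := hn.summable.tendsto_atTop_zero
  have hlim : Tendsto (fun K => (2 + δ) * ∑ k ∈ Finset.range K, ‖u k‖ ^ 2 + 2 * ‖u K‖ ^ 2) atTop
      (𝓝 ((2 + δ) * ‖u‖ ^ 2 + 2 * 0)) :=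
    (hn.tendsto_sum_nat.const_mul _).add (hn0.const_mul _)
  rw [mul_zero, add_zero] at hlim
  refine le_of_tendsto_of_tendsto hform hlim ?_
  filter_upwards [eventually_ge_atTop (cutSite M)] with K hK
  have h1 := key (fun j => (τ ^ j) * (u j).re) (fun k hk => by simp [hu k hk])
    (fun j h1 h2 => by simp [hcut j h1 h2]) K hK
  have h2 := key (fun j => (τ ^ j) * (u j).im) (fun k hk => by simp [hu k hk])
    (fun j h1 h2 => by simp [hcut j h1 h2]) K hK
  have hsq : ∀ j, (τ ^ j * (u j).re) ^ 2 + (τ ^ j * (u j).im) ^ 2 = ‖u j‖ ^ 2 := by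
    intro j
    have hj : (τ ^ j) ^ 2 = 1 := by rw [← pow_mul, mul_comm, pow_mul, hτ, one_pow]
    rw [Complex.sq_norm, Complex.normSq_apply]
    linear_combination ((u j).re ^ 2 + (u j).im ^ 2) * hj
  rw [Finset.sum_add_distrib, ← Finset.sum_congr rfl fun k _ => hsq k, Finset.sum_add_distrib,
    ← hsq K]
  linarith

section Abstract

variable {X : Type*} [NormedAddCommGroup X] [InnerProductSpace ℂ X]

/-- In the span of vectors `e i` that are orthogonal with respect to both the inner product and the
form of `T`, there is a nonzero vector at which fewer linear functionals vanish; `w` are the squared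
moduli of its coefficients. -/
theorem exists_combination {ι κ : Type*} [Fintype ι] [Fintype κ] {T : X →L[ℂ] X} {e : ι → X}
    (h1 : ∀ i j, i ≠ j → inner ℂ (e i) (e j) = 0)
    (h2 : ∀ i j, i ≠ j → inner ℂ (e i) (T (e j)) = 0) (L : κ → X →ₗ[ℂ] ℂ)
    (hcard : Fintype.card κ < Fintype.card ι) :
    ∃ (u : X) (w : ι → ℝ), (∀ k, L k u = 0) ∧ (∀ i, 0 ≤ w i) ∧ (∃ i, 0 < w i) ∧
      ‖u‖ ^ 2 = ∑ i, w i * ‖e i‖ ^ 2 ∧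
      (inner ℂ u (T u)).re = ∑ i, w i * (inner ℂ (e i) (T (e i))).re := by
  classical
  let Φ : (ι → ℂ) →ₗ[ℂ] X := Fintype.linearCombination ℂ e
  let Ψ : (ι → ℂ) →ₗ[ℂ] (κ → ℂ) := LinearMap.pi fun k => (L k).comp Φ
  obtain ⟨c, hc0, hc⟩ : ∃ c : ι → ℂ, c ≠ 0 ∧ Ψ c = 0 := by
    have := LinearMap.ker_ne_bot_of_finrank_lt (f := Ψ) (by simpa using hcard)
    obtain ⟨c, hc, hc0⟩ := Submodule.exists_mem_ne_zero_of_ne_bot this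
    exact ⟨c, hc0, hc⟩
  set u := Φ c with hu
  have hu' : u = ∑ i, c i • e i := by
    rw [hu]; exact Fintype.linearCombination_apply ℂ e c
  have hform : ∀ A : X →L[ℂ] X, (∀ i j, i ≠ j → inner ℂ (e i) (A (e j)) = 0) →
      (inner ℂ u (A u)).re = ∑ i, ‖c i‖ ^ 2 * (inner ℂ (e i) (A (e i))).re := by
    intro A hA
    rw [hu', map_sum, sum_inner, Complex.re_sum]
    refine Finset.sum_congr rfl fun i _ => ?_
    rw [inner_sum, Finset.sum_eq_single i]
    · rw [map_smul, inner_smul_left, inner_smul_right, ← mul_assoc,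
        mul_comm ((starRingEnd ℂ) (c i)), Complex.mul_conj, Complex.re_ofReal_mul,
        Complex.normSq_eq_norm_sq]
    · intro j _ hj
      rw [map_smul, inner_smul_left, inner_smul_right, hA i j hj.symm]
      simp
    · simp
  refine ⟨u, fun i => ‖c i‖ ^ 2, fun k => congrFun hc k, fun i => by positivity, ?_, ?_,
    hform T h2⟩
  · obtain ⟨i, hi⟩ := Function.ne_iff.1 hc0
    have : 0 < ‖c i‖ := norm_pos_iff.2 hi
    exact ⟨i, by positivity⟩
  · have h := hform (ContinuousLinearMap.id ℂ X) h1
    have hsq : ∀ v : X, (inner ℂ v (ContinuousLinearMap.id ℂ X v)).re = ‖v‖ ^ 2 :=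
      fun v => inner_self_eq_norm_sq (𝕜 := ℂ) v
    simpa only [hsq] using h

end Abstract

/-- At most `cutSite J + M` eigenvalues lie beyond the form bound at the edge `2τ`. -/
theorem card_eigenvalues_le {a b τ : ℝ} (hτ : τ ^ 2 = 1) {J : ℕ} (hJ : 202 ≤ J)
    (hJ' : ∀ n : ℕ, cutSite J ≤ n → 8 ≤ Real.log n ∧ 200 * Real.log n ≤ n) {M : ℕ} (hM : J ≤ M)
    {S : Finset ℝ}
    (hS : ∀ x ∈ S, Module.End.HasEigenvalue (opPot a b : HalfLine →ₗ[ℂ] HalfLine) (x : ℂ))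
    (hS' : ∀ x ∈ S, 2 + 4 * Real.exp (-((M : ℝ) ^ 2 / 50)) < τ * x) :
    S.card ≤ cutSite J + (M + 1) := by
  by_contra hlt
  let F : Finset ℕ := Finset.range (cutSite J) ∪ (Finset.range (M + 1)).image fun j => cutSite j - 1
  have hF : F.card ≤ cutSite J + (M + 1) := by
    refine (Finset.card_union_le _ _).trans ?_
    rw [Finset.card_range]
    refine Nat.add_le_add_left ?_ _
    simpa using Finset.card_image_le (s := Finset.range (M + 1)) (f := fun j => cutSite j - 1)
  have hex : ∀ x : S, ∃ v,
      Module.End.HasEigenvector (opPot a b : HalfLine →ₗ[ℂ] HalfLine) ((x : ℝ) : ℂ) v :=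
    fun x => (hS x x.2).exists_hasEigenvector
  choose e he using hex
  have hTe : ∀ x : S, opPot a b (e x) = ((x : ℝ) : ℂ) • e x := fun x => (he x).apply_eq_smul
  have hsa : IsSelfAdjoint (opPot a b) := isSelfAdjoint_opH (pot a b) (pot_bounded a b)
  have horth : ∀ x y : S, x ≠ y → inner ℂ (e x) (e y) = 0 := by
    intro x y hxy
    have hsym := ContinuousLinearMap.isSelfAdjoint_iff_isSymmetric.1 hsa
    exact hsym.orthogonalFamily_eigenspaces
      (fun h => hxy (Subtype.ext (Complex.ofReal_injective h)))
      ⟨e x, (he x).1⟩ ⟨e y, (he y).1⟩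
  obtain ⟨u, w, hu, hw, ⟨x₀, hwx⟩, hn, hf⟩ := exists_combination (T := opPot a b) horth
    (fun x y hxy => by rw [hTe, inner_smul_right, horth x y hxy, mul_zero])
    (fun k : F => (lp.evalCLM ℂ (fun _ : ℕ => ℂ) 2 (k : ℕ)).toLinearMap) (by simp; omega)
  have hu' : ∀ k ∈ F, u k = 0 := fun k hk => hu ⟨k, hk⟩
  have h := form_le_of_cuts (a := a) (b := b) hτ hJ hJ' hM (u := u)
    (fun k hk => hu' k (Finset.mem_union_left _ (Finset.mem_range.2 hk)))
    (fun j _ hj => hu' _ (Finset.mem_union_right _ (Finset.mem_image.2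
      ⟨j, Finset.mem_range.2 (by omega), rfl⟩)))
  have hex : ∀ x : S, (inner ℂ (e x) (opPot a b (e x))).re = x * ‖e x‖ ^ 2 := by
    intro x
    rw [hTe, inner_smul_right, Complex.re_ofReal_mul]
    congr 1
    exact inner_self_eq_norm_sq (𝕜 := ℂ) (e x)
  rw [hf, hn, Finset.mul_sum, Finset.mul_sum] at h
  have hterm : ∀ x : S, τ * (w x * (inner ℂ (e x) (opPot a b (e x))).re) =
      τ * x * (w x * ‖e x‖ ^ 2) := by
    intro x
    rw [hex]
    ring
  rw [Finset.sum_congr rfl fun x _ => hterm x] at h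
  refine absurd h (not_le.2 (Finset.sum_lt_sum (fun x _ => ?_) ⟨x₀, Finset.mem_univ _, ?_⟩))
  · exact mul_le_mul_of_nonneg_right (hS' x x.2).le (mul_nonneg (hw x) (by positivity))
  · have : 0 < ‖e x₀‖ := norm_pos_iff.2 (he x₀).2
    exact mul_lt_mul_of_pos_right (hS' x₀ x₀.2) (mul_pos hwx (by positivity))

theorem edgeDist_le {x δ : ℝ} (hδ : 0 ≤ δ) (h : |x| ≤ 2 + δ) : edgeDist x ≤ δ := by
  obtain ⟨h1, h2⟩ := abs_le.1 h
  have hm : max (-2) (min x 2) ∈ Set.Icc (-2 : ℝ) 2 :=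
    ⟨le_max_left _ _, max_le (by norm_num) (min_le_right _ _)⟩
  refine (Metric.infDist_le_dist_of_mem hm).trans ?_
  rw [Real.dist_eq, abs_le]
  rcases le_total x 2 with h3 | h3 <;> rcases le_total (-2) x with h4 | h4
  · rw [min_eq_left h3, max_eq_right h4]; constructor <;> linarith
  · rw [min_eq_left h3, max_eq_left h4]; constructor <;> linarith
  · rw [min_eq_right h3, max_eq_right (by norm_num)]; constructor <;> linarith
  · linarith

theorem edgeDist_pos {x : ℝ} (h : x ∉ Set.Icc (-2 : ℝ) 2) : 0 < edgeDist x :=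
  (isClosed_Icc.notMem_iff_infDist_pos ⟨0, by norm_num⟩).1 h

/-- The number of eigenvalues at a distance greater than `4 exp (-M² / 50)` from `[-2, 2]` grows at
most linearly in `M`. -/
theorem exists_count_bound (a b : ℝ) : ∃ K₀ : ℕ, ∀ M : ℕ, ∀ S : Finset ℝ,
    (∀ x ∈ S, Module.End.HasEigenvalue (opPot a b : HalfLine →ₗ[ℂ] HalfLine) (x : ℂ)) →
    (∀ x ∈ S, 4 * Real.exp (-((M : ℝ) ^ 2 / 50)) < edgeDist x) → S.card ≤ K₀ + 2 * M := by
  obtain ⟨J, hJ, hJ'⟩ := exists_first_cut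
  refine ⟨2 * (cutSite J + 1) + 2 * J, fun M S hS hd => ?_⟩
  set M' := max J M with hM'
  have hle : 4 * Real.exp (-((M' : ℝ) ^ 2 / 50)) ≤ 4 * Real.exp (-((M : ℝ) ^ 2 / 50)) := by
    have : (M : ℝ) ≤ M' := by exact_mod_cast le_max_right J M
    gcongr
  have hsplit : S = S.filter (fun x => 2 + 4 * Real.exp (-((M' : ℝ) ^ 2 / 50)) < 1 * x) ∪
      S.filter (fun x => 2 + 4 * Real.exp (-((M' : ℝ) ^ 2 / 50)) < (-1) * x) := by
    ext x
    simp only [Finset.mem_union, Finset.mem_filter]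
    constructor
    · intro hx
      by_contra hcon
      have h1 : ¬ 2 + 4 * Real.exp (-((M' : ℝ) ^ 2 / 50)) < 1 * x := fun h => hcon (Or.inl ⟨hx, h⟩)
      have h2 : ¬ 2 + 4 * Real.exp (-((M' : ℝ) ^ 2 / 50)) < (-1) * x :=
        fun h => hcon (Or.inr ⟨hx, h⟩)
      have h3 : |x| ≤ 2 + 4 * Real.exp (-((M' : ℝ) ^ 2 / 50)) :=
        abs_le.2 ⟨by linarith, by linarith⟩
      have h4 := edgeDist_le (by positivity) h3
      linarith [hd x hx]
    · rintro (h | h) <;> exact h.1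
  have h1 := card_eigenvalues_le (a := a) (b := b) (τ := 1) (by norm_num) hJ hJ' (le_max_left J M)
    (S := S.filter (fun x => 2 + 4 * Real.exp (-((M' : ℝ) ^ 2 / 50)) < 1 * x))
    (fun x hx => hS x (Finset.mem_filter.1 hx).1) (fun x hx => (Finset.mem_filter.1 hx).2)
  have h2 := card_eigenvalues_le (a := a) (b := b) (τ := -1) (by norm_num) hJ hJ' (le_max_left J M)
    (S := S.filter (fun x => 2 + 4 * Real.exp (-((M' : ℝ) ^ 2 / 50)) < (-1) * x))
    (fun x hx => hS x (Finset.mem_filter.1 hx).1) (fun x hx => (Finset.mem_filter.1 hx).2)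
  have h3 : S.card ≤ (cutSite J + (M' + 1)) + (cutSite J + (M' + 1)) := by
    rw [hsplit]
    exact (Finset.card_union_le _ _).trans (add_le_add h1 h2)
  have h4 : M' ≤ J + M := max_le (by omega) (by omega)
  omega

/-! ### Infinitely many eigenvalues above the interval -/

/-- The trapezoid that vanishes outside `[1, 4]` and equals `1` on `[2, 3]`. -/
def trapezoid (s : ℝ) : ℝ := max 0 (min 1 (min (s - 1) (4 - s)))

theorem abs_trapezoid_sub_le (s t : ℝ) : |trapezoid s - trapezoid t| ≤ |s - t| := by
  unfold trapezoid
  refine (abs_max_sub_max_le_max _ _ _ _).trans ?_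
  rw [sub_zero, abs_zero]
  refine max_le (abs_nonneg _) ((abs_min_sub_min_le_max _ _ _ _).trans ?_)
  rw [sub_self, abs_zero]
  refine max_le (abs_nonneg _) ((abs_min_sub_min_le_max _ _ _ _).trans (max_le ?_ ?_))
  · exact le_of_eq (by congr 1; ring)
  · rw [abs_sub_comm]
    exact le_of_eq (by congr 1; ring)

theorem trapezoid_eq_zero {s : ℝ} (h : s ≤ 1 ∨ 4 ≤ s) : trapezoid s = 0 := by
  refine max_eq_left ((min_le_right _ _).trans ?_)
  rcases h with h | h
  · exact (min_le_left _ _).trans (by linarith)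
  · exact (min_le_right _ _).trans (by linarith)

theorem trapezoid_eq_one {s : ℝ} (h2 : 2 ≤ s) (h3 : s ≤ 3) : trapezoid s = 1 := by
  unfold trapezoid
  rw [min_eq_left (le_min (by linarith) (by linarith)), max_eq_right zero_le_one]

theorem log_two_pow (k : ℕ) : Real.log ((2 ^ k : ℕ) : ℝ) = k * Real.log 2 := by
  push_cast
  rw [Real.log_pow]

/-- Far out there are trial vectors whose energy exceeds the edge `2`: after the ground state
transform one takes a trapezoid in the variable `ln n`. -/
theorem exists_trial (a b : ℝ) : ∃ k₀ : ℕ, 1 ≤ k₀ ∧ ∀ k, k₀ ≤ k → ∃ φ : HalfLine,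
    (∀ j, φ j ≠ 0 → 2 ^ k < j + 1 ∧ j + 1 < 2 ^ (4 * k)) ∧
      2 * ‖φ‖ ^ 2 < (inner ℂ φ (opPot a b φ)).re := by
  obtain ⟨N, hN⟩ := exists_threshold
  refine ⟨max 200 N, le_trans (by norm_num) (le_max_left _ _), fun k hk => ?_⟩
  have hk200 : 200 ≤ k := (le_max_left _ _).trans hk
  have hkN : N ≤ 2 ^ k := ((le_max_right _ _).trans hk).trans Nat.lt_two_pow_self.le
  set T := (k : ℝ) * Real.log 2 with hT
  have hT80 : 80 < T := by
    have h1 : (200 : ℝ) ≤ k := by exact_mod_cast hk200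
    have := Real.log_two_gt_d9
    nlinarith
  have hT0 : 0 < T := by linarith
  have hτ : (1 : ℝ) ^ 2 = 1 := one_pow 2
  set g := groundState 1 with hg
  set A := 2 ^ k with hA
  set B := 2 ^ (4 * k) with hB
  have hlogA : Real.log (A : ℝ) = T := log_two_pow k
  have hlogB : Real.log (B : ℝ) = 4 * T := by
    rw [hB, log_two_pow, hT]
    push_cast
    ring
  have h2A : 2 ≤ A := by
    calc 2 = 2 ^ 1 := rfl
      _ ≤ 2 ^ k := Nat.pow_le_pow_right (by norm_num) (by omega)
  have hAB : A ≤ B := Nat.pow_le_pow_right (by norm_num) (by omega)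
  have hest := fun n (hn : A ≤ n) => groundState_estimates hτ (hN n (hkN.trans hn)).1
    (hN n (hkN.trans hn)).2
  set y : ℕ → ℝ := fun n => trapezoid (Real.log n / T) with hy
  have hyA : ∀ n, 1 ≤ n → n ≤ A → y n = 0 := by
    intro n h1 hn
    refine trapezoid_eq_zero (Or.inl ?_)
    rw [div_le_one hT0, ← hlogA]
    exact Real.log_le_log (by exact_mod_cast h1) (by exact_mod_cast hn)
  have hyB : ∀ n, B ≤ n → y n = 0 := by
    intro n hn
    refine trapezoid_eq_zero (Or.inr ?_)
    rw [le_div_iff₀ hT0, ← hlogB]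
    exact Real.log_le_log (by exact_mod_cast (by omega : 0 < B)) (by exact_mod_cast hn)
  set f : ℕ → ℝ := fun j => g (j + 1) * y (j + 1) with hf
  have hfsupp : ∀ j, f j ≠ 0 → A < j + 1 ∧ j + 1 < B := by
    intro j hj
    have hy0 : y (j + 1) ≠ 0 := right_ne_zero_of_mul hj
    constructor
    · by_contra h
      exact hy0 (hyA (j + 1) (by omega) (by omega))
    · by_contra h
      exact hy0 (hyB (j + 1) (by omega))
  have hf0 : ∀ j, j ∉ Finset.range B → f j = 0 := by
    intro j hj
    by_contra h
    have := (hfsupp j h).2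
    exact hj (Finset.mem_range.2 (by omega))
  have hnorm : HasSum (fun j => ‖(f j : ℂ)‖ ^ 2) (∑ j ∈ Finset.range B, f j ^ 2) := by
    have h := hasSum_sum_of_ne_finset_zero (L := SummationFilter.unconditional ℕ)
      (f := fun j => ‖(f j : ℂ)‖ ^ 2) (s := Finset.range B) (fun j hj => by simp [hf0 j hj])
    simpa using h
  let φ : HalfLine := ⟨fun j => (f j : ℂ), (memlp_iff _).2 hnorm.summable⟩
  have hφn : ‖φ‖ ^ 2 = ∑ j ∈ Finset.range B, f j ^ 2 := (hasSum_norm_sq φ).unique hnorm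
  have hφf : (inner ℂ φ (opPot a b φ)).re =
      ∑ j ∈ Finset.range B, formTerm (pot a b) f j := by
    refine (hasSum_form (pot a b) (pot_bounded a b) φ).unique ?_
    have e : (fun j => formTerm (pot a b) (fun i => (φ i).re) j +
        formTerm (pot a b) (fun i => (φ i).im) j) = formTerm (pot a b) f := by
      funext j
      have h1 : ∀ i, (φ i).re = f i := fun i => Complex.ofReal_re _
      have h2 : ∀ i, (φ i).im = 0 := fun i => Complex.ofReal_im _
      simp only [formTerm, h1, h2]
      ring
    rw [e]
    exact hasSum_sum_of_ne_finset_zero fun j hj => by simp [formTerm, hf0 j hj]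
  refine ⟨φ, fun j hj => hfsupp j fun h => hj ?_, ?_⟩
  · change ((f j : ℝ) : ℂ) = 0
    rw [h, Complex.ofReal_zero]
  have hid := sum_form_eq g (fun n => altSign 1 n * osc n) y B
  rw [hyA 1 le_rfl (by omega), hyB (B + 1) (by omega)] at hid
  have e1 : ∑ j ∈ Finset.range B, formTerm (pot a b) f j =
      ∑ k ∈ Finset.range B, (2 * (g (k + 1) * y (k + 1)) * (g (k + 2) * y (k + 2)) +
        (altSign 1 (k + 1) * osc (k + 1 : ℕ) - 2) * (g (k + 1) * y (k + 1)) ^ 2) +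
        2 * ∑ j ∈ Finset.range B, f j ^ 2 := by
    rw [Finset.mul_sum, ← Finset.sum_add_distrib]
    refine Finset.sum_congr rfl fun j _ => ?_
    have h := pot_succ_mul_eq a b 1 (f := f) (fun j hj => by
      by_contra h
      have := (hfsupp j h).1
      omega) j
    rw [one_mul] at h
    simp only [formTerm]
    rw [h]
    simp only [hf]
    ring
  have e2 : ∑ k ∈ Finset.range B, (g (k + 1) * (g (k + 2) + g k +
        (altSign 1 (k + 1) * osc (k + 1 : ℕ) - 2) * g (k + 1)) *
        y (k + 1) ^ 2 - g (k + 1) * g (k + 2) * (y (k + 2) - y (k + 1)) ^ 2) =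
      ∑ n ∈ Finset.Ico 1 (B + 1), (effPot 1 n * y n ^ 2 -
        g n * g (n + 1) * (y (n + 1) - y n) ^ 2) := by
    rw [Finset.sum_Ico_eq_sum_range]
    refine Finset.sum_congr rfl fun k _ => ?_
    rw [add_comm 1 k]
    rfl
  have e3 : ∑ n ∈ Finset.Ico 1 (B + 1), (effPot 1 n * y n ^ 2 -
        g n * g (n + 1) * (y (n + 1) - y n) ^ 2) =
      ∑ n ∈ Finset.Ico A B, effPot 1 n * y n ^ 2 -
        ∑ n ∈ Finset.Ico A B, g n * g (n + 1) * (y (n + 1) - y n) ^ 2 := by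
    rw [← Finset.sum_sub_distrib, ← Finset.sum_Ico_consecutive _ (by omega : 1 ≤ A)
      (by omega : A ≤ B + 1), Finset.sum_Ico_succ_top hAB, hyB B le_rfl, hyB (B + 1) (by omega)]
    rw [Finset.sum_eq_zero fun n hn => by
      obtain ⟨h1, h2⟩ := Finset.mem_Ico.1 hn
      rw [hyA n h1 h2.le, hyA (n + 1) (by omega) (by omega)]
      ring]
    ring
  -- the gain from the effective potential
  have hgain : 1 / 6 ≤ ∑ n ∈ Finset.Ico A B, effPot 1 n * y n ^ 2 := by
    have hsub : Finset.Ico (2 ^ (2 * k)) (2 ^ (3 * k)) ⊆ Finset.Ico A B :=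
      Finset.Ico_subset_Ico (Nat.pow_le_pow_right (by norm_num) (by omega))
        (Nat.pow_le_pow_right (by norm_num) (by omega))
    have hnonneg : ∀ n ∈ Finset.Ico A B, 0 ≤ effPot 1 n * y n ^ 2 := by
      intro n hn
      have hAn := (Finset.mem_Ico.1 hn).1
      have hl := (hN n (hkN.trans hAn)).1
      refine mul_nonneg (le_trans ?_ (hest n hAn).2.2.2.2.1) (sq_nonneg _)
      have : 0 ≤ Real.log n := by linarith
      positivity
    refine le_trans ?_ (Finset.sum_le_sum_of_subset_of_nonneg hsub fun n hn _ => hnonneg n hn)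
    have hpt : ∀ n : ℕ, n ∈ Finset.Ico (2 ^ (2 * k)) (2 ^ (3 * k)) →
        1 / (6 * T) * (1 / (n : ℝ)) ≤ effPot 1 n * y n ^ 2 := by
      intro n hn
      have hAn := (Finset.mem_Ico.1 (hsub hn)).1
      obtain ⟨h1, h2⟩ := Finset.mem_Ico.1 hn
      have hn0 : (0 : ℝ) < n := by exact_mod_cast (by omega : 0 < n)
      have l1 : 2 * T ≤ Real.log n := by
        have h := Real.log_le_log (by positivity) (show ((2 ^ (2 * k) : ℕ) : ℝ) ≤ n by
          exact_mod_cast h1)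
        rw [log_two_pow] at h
        push_cast at h
        linarith
      have l2 : Real.log n ≤ 3 * T := by
        have h := Real.log_le_log hn0 (show (n : ℝ) ≤ ((2 ^ (3 * k) : ℕ) : ℝ) by
          exact_mod_cast h2.le)
        rw [log_two_pow] at h
        push_cast at h
        linarith
      have hy1 : y n = 1 := by
        refine trapezoid_eq_one ?_ ?_
        · rwa [le_div_iff₀ hT0]
        · rwa [div_le_iff₀ hT0]
      rw [hy1, one_pow, mul_one]
      refine le_trans ?_ (hest n hAn).2.2.2.2.1
      rw [one_div_mul_one_div]
      have : 0 < Real.log n := by linarith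
      refine one_div_le_one_div_of_le (by positivity) ?_
      nlinarith
    refine le_trans ?_ (Finset.sum_le_sum hpt)
    rw [← Finset.mul_sum]
    have h := le_sum_inv (A := 2 ^ (2 * k)) (B := 2 ^ (3 * k)) Nat.one_le_two_pow
      (Nat.pow_le_pow_right (by norm_num) (by omega))
    rw [log_two_pow, log_two_pow] at h
    push_cast at h
    rw [show 3 * (k : ℝ) * Real.log 2 - 2 * (k : ℝ) * Real.log 2 = T by rw [hT]; ring] at h
    calc (1 : ℝ) / 6 = 1 / (6 * T) * T := by field_simp
      _ ≤ _ := mul_le_mul_of_nonneg_left h (by positivity)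
  -- the kinetic cost of the trapezoid
  have hcost : ∑ n ∈ Finset.Ico A B, g n * g (n + 1) * (y (n + 1) - y n) ^ 2 ≤ 12 / T := by
    have hpt : ∀ n ∈ Finset.Ico A B, g n * g (n + 1) * (y (n + 1) - y n) ^ 2 ≤
        2 / T ^ 2 * (1 / (n : ℝ)) := by
      intro n hn
      have hAn := (Finset.mem_Ico.1 hn).1
      have hn1 : (1 : ℝ) ≤ n := by exact_mod_cast (by omega : 1 ≤ n)
      have hn0 : (0 : ℝ) < n := by linarith
      have hg1 := hest n hAn
      have hg2 := hest (n + 1) (by omega)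
      have hsq : √((n + 1 : ℕ) : ℝ) ≤ 3 / 2 * √(n : ℝ) := by
        rw [show (3 : ℝ) / 2 * √(n : ℝ) = √((3 / 2) ^ 2 * n) by
          rw [Real.sqrt_mul (by positivity), Real.sqrt_sq (by norm_num)]]
        refine Real.sqrt_le_sqrt ?_
        push_cast
        linarith
      have hw : g n * g (n + 1) ≤ 2 * n := by
        have h1 : g (n + 1) ≤ 27 / 16 * √(n : ℝ) := by linarith [hg2.2.2.1]
        have h2 := mul_le_mul hg1.2.2.1 h1 hg2.2.1.le (by positivity)
        have h5 : √(n : ℝ) * √n = n := Real.mul_self_sqrt n.cast_nonneg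
        nlinarith
      have hd : |y (n + 1) - y n| ≤ 1 / (n * T) := by
        refine (abs_trapezoid_sub_le _ _).trans ?_
        rw [← sub_div, abs_div, abs_of_pos hT0,
          show 1 / ((n : ℝ) * T) = 1 / (n : ℝ) / T by rw [div_div]]
        refine div_le_div_of_nonneg_right ?_ hT0.le
        have hl := log_succ_sub_log_bounds (n := n) (by omega)
        have h0 : 0 < 1 / (n : ℝ) := by positivity
        rw [abs_of_nonneg (by linarith [hl.1])]
        exact hl.2
      have hd2 := pow_le_pow_left₀ (abs_nonneg _) hd 2
      rw [sq_abs] at hd2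
      calc g n * g (n + 1) * (y (n + 1) - y n) ^ 2 ≤ 2 * n * (1 / (n * T)) ^ 2 :=
            mul_le_mul hw hd2 (sq_nonneg _) (by positivity)
        _ = 2 / T ^ 2 * (1 / (n : ℝ)) := by field_simp
    refine (Finset.sum_le_sum hpt).trans ?_
    rw [← Finset.mul_sum]
    have h := sum_inv_le (by omega : 1 ≤ A) hAB
    rw [hlogA, hlogB] at h
    calc 2 / T ^ 2 * ∑ n ∈ Finset.Ico A B, 1 / (n : ℝ) ≤ 2 / T ^ 2 * (2 * (4 * T - T)) :=
          mul_le_mul_of_nonneg_left h (by positivity)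
      _ = 12 / T := by
          field_simp
          ring
  have h12 : 12 / T < 1 / 6 := by
    rw [div_lt_div_iff₀ hT0 (by norm_num)]
    linarith
  rw [hφf, hφn, e1]
  have e5 : ∑ k ∈ Finset.range B, (2 * (g (k + 1) * y (k + 1)) * (g (k + 2) * y (k + 2)) +
        (altSign 1 (k + 1) * osc (k + 1 : ℕ) - 2) * (g (k + 1) * y (k + 1)) ^ 2) =
      ∑ n ∈ Finset.Ico A B, effPot 1 n * y n ^ 2 -
        ∑ n ∈ Finset.Ico A B, g n * g (n + 1) * (y (n + 1) - y n) ^ 2 := by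
    rw [hid, e2, e3]
    ring
  rw [e5]
  linarith

/-- Vectors with separated supports are orthogonal, also with respect to the form of `H`. -/
theorem inner_eq_zero_of_separated (V : ℕ → ℝ) (hV : ∃ M, ∀ n, |V n| ≤ M) {u v : HalfLine}
    (h : ∀ i j, u i ≠ 0 → v j ≠ 0 → i + 1 < j ∨ j + 1 < i) :
    inner ℂ u v = 0 ∧ inner ℂ u (opH V hV v) = 0 := by
  have hz : ∀ i j, i ≤ j + 1 → j ≤ i + 1 → (starRingEnd ℂ) (u i) * v j = 0 := by
    intro i j h1 h2
    by_contra h0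
    have hu : u i ≠ 0 := by
      intro h3; rw [h3] at h0; simp at h0
    have hv : v j ≠ 0 := right_ne_zero_of_mul h0
    rcases h i j hu hv with h3 | h3 <;> omega
  constructor
  · refine (lp.hasSum_inner u v).unique ?_
    have : (fun i => inner ℂ (u i) (v i)) = fun _ => (0 : ℂ) := by
      funext i
      rw [RCLike.inner_apply, mul_comm]
      exact hz i i (by omega) (by omega)
    rw [this]
    exact hasSum_zero
  · refine (hasSum_inner_opH V hV u v).unique ?_
    have : (fun k => (starRingEnd ℂ) (u k) * v (k + 1) + (starRingEnd ℂ) (u (k + 1)) * v k +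
      (V (k + 1) : ℂ) * ((starRingEnd ℂ) (u k) * v k)) = fun _ => (0 : ℂ) := by
      funext k
      rw [hz k (k + 1) (by omega) (by omega), hz (k + 1) k (by omega) (by omega),
        hz k k (by omega) (by omega)]
      simp
    rw [this]
    exact hasSum_zero

theorem tendsto_pot (a b : ℝ) : Tendsto (pot a b) atTop (𝓝 0) := by
  rw [tendsto_zero_iff_abs_tendsto_zero]
  have h3 : Tendsto (fun n : ℕ => 3 * (1 / (n : ℝ))) atTop (𝓝 0) := by
    simpa using (tendsto_one_div_atTop_nhds_zero_nat (𝕜 := ℝ)).const_mul 3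
  refine squeeze_zero' (Eventually.of_forall fun n => abs_nonneg _) ?_ h3
  filter_upwards [eventually_ge_atTop 3] with n hn
  have hn3 : (3 : ℝ) ≤ n := by exact_mod_cast hn
  have hl : 1 ≤ Real.log n := by
    rw [Real.le_log_iff_exp_le (by linarith)]
    linarith [Real.exp_one_lt_d9]
  have h2 : 2 / Real.log n ≤ 2 := by
    rw [div_le_iff₀ (by linarith)]; linarith
  simp only [Function.comp]
  rw [pot_eq_osc a b hn, abs_mul, abs_pow, abs_neg, abs_one, one_pow, one_mul,
    abs_of_pos (osc_pos (by linarith)), osc, mul_comm]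
  refine mul_le_mul_of_nonneg_right (by linarith) (by positivity)

theorem infinite_eigenvalues (a b : ℝ) :
    {x : ℝ | 2 < x ∧ Module.End.HasEigenvalue
      (opPot a b : HalfLine →ₗ[ℂ] HalfLine) (x : ℂ)}.Infinite := by
  intro hfin
  set S := hfin.toFinset with hS
  have hmem : ∀ x, x ∈ S ↔ 2 < x ∧ Module.End.HasEigenvalue
      (opPot a b : HalfLine →ₗ[ℂ] HalfLine) (x : ℂ) := fun x => hfin.mem_toFinset
  set H := opPot a b with hH
  have hsa : IsSelfAdjoint H := isSelfAdjoint_opH (pot a b) (pot_bounded a b)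
  have hsym : ∀ u v, inner ℂ (H u) v = inner ℂ u (H v) :=
    ContinuousLinearMap.isSelfAdjoint_iff_isSymmetric.1 hsa
  -- normalized eigenvectors
  have hex : ∀ x : S, ∃ v, ‖v‖ = 1 ∧ H v = ((x : ℝ) : ℂ) • v := by
    intro x
    obtain ⟨v, hv⟩ := ((hmem x).1 x.2).2.exists_hasEigenvector
    have hv0 : ‖v‖ ≠ 0 := norm_ne_zero_iff.2 hv.2
    refine ⟨((‖v‖⁻¹ : ℝ) : ℂ) • v, ?_, ?_⟩
    · rw [norm_smul, Complex.norm_real, norm_inv, norm_norm, inv_mul_cancel₀ hv0]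
    · rw [map_smul, smul_comm]
      congr 1
      exact hv.apply_eq_smul
  choose e he1 heH using hex
  have horth : ∀ x y : S, x ≠ y → inner ℂ (e x) (e y) = 0 := by
    intro x y hxy
    have hs := ContinuousLinearMap.isSelfAdjoint_iff_isSymmetric.1 hsa
    exact hs.orthogonalFamily_eigenspaces
      (fun h => hxy (Subtype.ext (Complex.ofReal_injective h)))
      ⟨e x, Module.End.mem_eigenspace_iff.2 (heH x)⟩ ⟨e y, Module.End.mem_eigenspace_iff.2 (heH y)⟩
  -- removing the eigenvalues above `2` from `H` is a compact perturbation
  let R : HalfLine →L[ℂ] HalfLine :=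
    ∑ x : S, (((x : ℝ) : ℂ) • InnerProductSpace.rankOne ℂ (e x) (e x))
  have hRa : ∀ u, R u = ∑ x : S, (((x : ℝ) : ℂ) * inner ℂ (e x) u) • e x := by
    intro u
    simp only [R, sum_apply, smul_apply, InnerProductSpace.rankOne_apply, smul_smul]
  have hRsa : IsSelfAdjoint R := by
    refine isSelfAdjoint_sum _ fun x _ => ?_
    refine IsSelfAdjoint.smul (Complex.conj_ofReal _) ?_
    rw [ContinuousLinearMap.isSelfAdjoint_iff_isSymmetric]
    exact InnerProductSpace.isSymmetric_rankOne_self _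
  have hRc : IsCompactOperator R := by
    refine Submodule.sum_mem (compactOperator (RingHom.id ℂ) HalfLine HalfLine) fun x _ => ?_
    refine Submodule.smul_mem _ _ ?_
    have : (InnerProductSpace.rankOne ℂ (e x) (e x) : HalfLine →L[ℂ] HalfLine) =
        (ContinuousLinearMap.toSpanSingleton ℂ (e x)).comp (innerSL ℂ (e x)) := by
      ext1 u
      simp
    rw [this]
    exact (isCompactOperator_of_locallyCompactSpace_rng
      (ContinuousLinearMap.toSpanSingleton ℂ (e x))).comp_clm _
  have hTsa : IsSelfAdjoint (H - R) := hsa.sub hRsa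
  -- a combination of trial vectors, orthogonal to the eigenvectors
  obtain ⟨k₀, hk₀, htrial⟩ := exists_trial a b
  have hk : ∀ i : Fin (S.card + 1), k₀ ≤ k₀ * 5 ^ (i : ℕ) :=
    fun i => Nat.le_mul_of_pos_right _ (by positivity)
  choose φ hφs hφf using fun i : Fin (S.card + 1) => htrial _ (hk i)
  have hsep : ∀ i j : Fin (S.card + 1), i ≠ j →
      inner ℂ (φ i) (φ j) = 0 ∧ inner ℂ (φ i) (H (φ j)) = 0 := by
    have hlt : ∀ i j : Fin (S.card + 1), i < j → ∀ m n, φ i m ≠ 0 → φ j n ≠ 0 → m + 1 < n := by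
      intro i j hij m n hm hn
      have h1 := (hφs i m hm).2
      have h2 := (hφs j n hn).1
      have h3 : 4 * (k₀ * 5 ^ (i : ℕ)) + 1 ≤ k₀ * 5 ^ (j : ℕ) := by
        have h4 : 5 ^ ((i : ℕ) + 1) ≤ 5 ^ (j : ℕ) := Nat.pow_le_pow_right (by norm_num) hij
        have h5 : k₀ * 5 ^ ((i : ℕ) + 1) ≤ k₀ * 5 ^ (j : ℕ) := Nat.mul_le_mul_left _ h4
        have h6 : 1 ≤ k₀ * 5 ^ (i : ℕ) := Nat.mul_pos hk₀ (by positivity)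
        rw [pow_succ] at h5
        nlinarith
      have h7 : 2 ^ (4 * (k₀ * 5 ^ (i : ℕ)) + 1) ≤ 2 ^ (k₀ * 5 ^ (j : ℕ)) :=
        Nat.pow_le_pow_right (by norm_num) h3
      rw [pow_succ] at h7
      omega
    intro i j hij
    refine inner_eq_zero_of_separated (pot a b) (pot_bounded a b) fun m n hm hn => ?_
    rcases lt_or_gt_of_ne hij with h | h
    · exact Or.inl (hlt i j h m n hm hn)
    · exact Or.inr (hlt j i h n m hn hm)
  obtain ⟨u, w, hu, hw, ⟨i₀, hw0⟩, hn, hf⟩ := exists_combination (T := H)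
    (fun i j hij => (hsep i j hij).1) (fun i j hij => (hsep i j hij).2)
    (fun x : S => (innerSL ℂ (e x)).toLinearMap) (by simp)
  have hRu : R u = 0 := by
    rw [hRa]
    refine Finset.sum_eq_zero fun x _ => ?_
    have : inner ℂ (e x) u = 0 := hu x
    rw [this, mul_zero, zero_smul]
  have hbig : 2 * ‖u‖ ^ 2 < (inner ℂ u ((H - R) u)).re := by
    rw [sub_apply, hRu, sub_zero, hn, hf, Finset.mul_sum]
    refine Finset.sum_lt_sum (fun i _ => ?_) ⟨i₀, Finset.mem_univ _, ?_⟩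
    · nlinarith [mul_le_mul_of_nonneg_left (hφf i).le (hw i)]
    · nlinarith [mul_lt_mul_of_pos_left (hφf i₀) hw0]
  -- hence the perturbed operator has an eigenvalue above `2`
  obtain ⟨z, hz, hz2⟩ : ∃ z ∈ spectrum ℝ (H - R), 2 < z := by
    by_contra! hcon
    have := (form_le_iff_spectrum_le hTsa 2).2 hcon u
    linarith
  have hzev : Module.End.HasEigenvalue ((H - R : HalfLine →L[ℂ] HalfLine) : HalfLine →ₗ[ℂ] HalfLine)
      (z : ℂ) := by
    refine hasEigenvalue_of_compact_perturbation
      (K := (opH (pot a b) (pot_bounded a b) - opH 0 zero_bounded) - R) ?_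
      ((isCompactOperator_potential _ _ (tendsto_pot a b)).sub hRc)
      (mem_resolventSet_free (x := z) fun h => by linarith [h.2]) ?_
    · rw [hH, opPot]
      abel
    · rw [← spectrum.algebraMap_mem_iff ℂ] at hz
      exact hz
  obtain ⟨v, hv⟩ := hzev.exists_hasEigenvector
  have hTv : (H - R) v = (z : ℂ) • v := hv.apply_eq_smul
  have hTe : ∀ x, (H - R) (e x) = 0 := by
    intro x
    rw [sub_apply, heH, hRa, Finset.sum_eq_single x]
    · rw [inner_self_eq_norm_sq_to_K, he1]
      simp
    · intro y _ hyx
      rw [horth y x hyx, mul_zero, zero_smul]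
    · simp
  have hTsym := ContinuousLinearMap.isSelfAdjoint_iff_isSymmetric.1 hTsa
  have hperp : ∀ x, inner ℂ (e x) v = 0 := by
    intro x
    have h1 : inner ℂ ((H - R) (e x)) v = inner ℂ (e x) ((H - R) v) := hTsym (e x) v
    rw [hTe, inner_zero_left, hTv, inner_smul_right] at h1
    rcases mul_eq_zero.1 h1.symm with h | h
    · exfalso
      have : z = 0 := by exact_mod_cast h
      linarith
    · exact h
  have hHv : H v = (z : ℂ) • v := by
    rw [← hTv, sub_apply, hRa, Finset.sum_eq_zero fun x _ => by
      rw [hperp, mul_zero, zero_smul], sub_zero]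
  have hzS : z ∈ S := by
    rw [hmem]
    exact ⟨hz2, Module.End.hasEigenvalue_of_hasEigenvector
      ⟨Module.End.mem_eigenspace_iff.2 hHv, hv.2⟩⟩
  -- by simplicity the new eigenvector is a multiple of one of the removed ones
  have hone := finrank_eigenspace_eq_one (pot a b) (pot_bounded a b) ((hmem z).1 hzS).2
  let ez : Module.End.eigenspace (H : HalfLine →ₗ[ℂ] HalfLine) (z : ℂ) :=
    ⟨e ⟨z, hzS⟩, Module.End.mem_eigenspace_iff.2 (heH ⟨z, hzS⟩)⟩
  have hez : ez ≠ 0 := by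
    intro h
    have h1 : e ⟨z, hzS⟩ = 0 := congrArg Subtype.val h
    have := he1 ⟨z, hzS⟩
    rw [h1, norm_zero] at this
    exact zero_ne_one this
  obtain ⟨c, hc⟩ := (finrank_eq_one_iff_of_nonzero' ez hez).1 hone
    ⟨v, Module.End.mem_eigenspace_iff.2 hHv⟩
  have hc' : c • e ⟨z, hzS⟩ = v := congrArg Subtype.val hc
  have h1 := hperp ⟨z, hzS⟩
  rw [← hc', inner_smul_right, inner_self_eq_norm_sq_to_K, he1] at h1
  have hc0 : c = 0 := by simpa using h1
  exact hv.2 (by rw [← hc', hc0, zero_smul])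

/-! ### Enumerating the discrete spectrum -/

/-- An infinite set on which a function has finite superlevel sets can be listed in the order of
non-increasing values, by picking a maximum of the remaining points at each step. -/
theorem exists_antitone_enumeration {S : Set ℝ} {d : ℝ → ℝ} (hS : S.Infinite)
    (hd : ∀ x ∈ S, 0 < d x) (hfin : ∀ ε, 0 < ε → {x ∈ S | ε ≤ d x}.Finite) :
    ∃ E : ℕ → ℝ, Function.Injective E ∧ Set.range E = S ∧ Antitone fun n => d (E n) := by
  classical
  have hmax : ∀ F : Finset ℝ, ∃ x ∈ S \ F, ∀ y ∈ S \ F, d y ≤ d x := by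
    intro F
    obtain ⟨x₀, hx₀⟩ := (hS.sdiff F.finite_toSet).nonempty
    have hfin' : {x ∈ S \ F | d x₀ ≤ d x}.Finite :=
      (hfin (d x₀) (hd x₀ hx₀.1)).subset fun x hx => ⟨hx.1.1, hx.2⟩
    obtain ⟨x, hx, hxm⟩ := hfin'.exists_maximalFor d _ ⟨x₀, hx₀, le_rfl⟩
    refine ⟨x, hx.1, fun y hy => ?_⟩
    rcases le_total (d x₀) (d y) with h | h
    · rcases le_total (d y) (d x) with h1 | h1
      · exact h1
      · exact hxm ⟨hy, h⟩ h1
    · exact h.trans hx.2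
  choose pick hpick hpickmax using hmax
  -- `used n` are the first `n` points of the list
  let used : ℕ → Finset ℝ := fun n => Nat.rec ∅ (fun _ F => insert (pick F) F) n
  have hused : ∀ n, used (n + 1) = insert (pick (used n)) (used n) := fun n => rfl
  have hmono : Monotone used :=
    monotone_nat_of_le_succ fun n => by rw [hused]; exact Finset.subset_insert _ _
  have hin : ∀ m n, m < n → pick (used m) ∈ used n := fun m n hmn =>
    hmono (Nat.succ_le_of_lt hmn) (by
      rw [Nat.succ_eq_add_one, hused]; exact Finset.mem_insert_self _ _)
  have hinj : Function.Injective fun n => pick (used n) := by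
    have hne : ∀ m n, m < n → pick (used m) ≠ pick (used n) := fun m n hmn h =>
      (hpick (used n)).2 (h ▸ hin m n hmn)
    intro m n h
    rcases lt_trichotomy m n with h1 | h1 | h1
    · exact absurd h (hne m n h1)
    · exact h1
    · exact absurd h.symm (hne n m h1)
  refine ⟨fun n => pick (used n), hinj, ?_, antitone_nat_of_succ_le fun n => ?_⟩
  · refine Set.Subset.antisymm (Set.range_subset_iff.2 fun n => (hpick _).1) fun x hx => ?_
    by_contra hnot
    have hge : ∀ n, d x ≤ d (pick (used n)) := by
      intro n
      refine hpickmax _ x ⟨hx, fun hxu => hnot ?_⟩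
      have hsub : ∀ n, ∀ y ∈ used n, y ∈ Set.range fun n => pick (used n) := by
        intro n
        induction n with
        | zero => simp [used]
        | succ n ih =>
          intro y hy
          rw [hused, Finset.mem_insert] at hy
          rcases hy with rfl | hy
          · exact ⟨n, rfl⟩
          · exact ih y hy
      exact hsub n x hxu
    exact Set.infinite_of_injective_forall_mem (s := {y ∈ S | d x ≤ d y}) hinj
      (fun n => ⟨(hpick (used n)).1, hge n⟩) (hfin (d x) (hd x hx))
  · have hnext := hpick (used (n + 1))
    exact hpickmax (used n) (pick (used (n + 1)))
      ⟨hnext.1, fun h => hnext.2 (hmono (Nat.le_succ n) h)⟩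

/-- The eigenvalues outside `[-2, 2]`. -/
def outerEigenvalues (a b : ℝ) : Set ℝ :=
  {x | x ∉ Set.Icc (-2 : ℝ) 2 ∧
    Module.End.HasEigenvalue (opPot a b : HalfLine →ₗ[ℂ] HalfLine) (x : ℂ)}

theorem spectrum_opPot (a b : ℝ) :
    spectrum ℂ (opPot a b) = (fun x : ℝ => (x : ℂ)) '' (Set.Icc (-2) 2 ∪ outerEigenvalues a b) := by
  have hsa : IsSelfAdjoint (opPot a b) := isSelfAdjoint_opH (pot a b) (pot_bounded a b)
  ext z
  constructor
  · intro hz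
    have hre := hsa.mem_spectrum_eq_re hz
    refine ⟨z.re, ?_, hre.symm⟩
    by_cases h : z.re ∈ Set.Icc (-2 : ℝ) 2
    · exact Or.inl h
    · refine Or.inr ⟨h, ?_⟩
      rw [hre] at hz
      exact hasEigenvalue_of_mem_spectrum _ _ (tendsto_pot a b) h hz
  · rintro ⟨x, hx | hx, rfl⟩
    · exact mem_spectrum_of_mem_Icc _ _ (tendsto_pot a b) hx
    · rw [ContinuousLinearMap.spectrum_eq]
      exact hx.2.mem_spectrum

theorem tendsto_exp_neg_sq_div : Tendsto (fun M : ℕ => 4 * Real.exp (-((M : ℝ) ^ 2 / 50))) atTop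
    (𝓝 0) := by
  have h : Tendsto (fun M : ℕ => (M : ℝ) ^ 2 / 50) atTop atTop :=
    ((tendsto_pow_atTop two_ne_zero).comp tendsto_natCast_atTop_atTop).atTop_div_const (by norm_num)
  simpa using (Real.tendsto_exp_neg_atTop_nhds_zero.comp h).const_mul 4

theorem exists_enumeration (a b : ℝ) : ∃ E : ℕ → ℝ,
    EnumeratesDiscreteSpectrum (opPot a b) E ∧ Set.range E = outerEigenvalues a b := by
  obtain ⟨K₀, hK₀⟩ := exists_count_bound a b
  obtain ⟨E, hinj, hrange, hanti⟩ := exists_antitone_enumeration (S := outerEigenvalues a b)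
    (d := edgeDist)
    ((infinite_eigenvalues a b).mono fun x hx => ⟨fun h => by linarith [h.2, hx.1], hx.2⟩)
    (fun x hx => edgeDist_pos hx.1)
    (fun ε hε => by
      obtain ⟨M, hM⟩ := (tendsto_exp_neg_sq_div.eventually_lt_const hε).exists
      by_contra hinf
      obtain ⟨F, hF, hcard⟩ := Set.Infinite.exists_subset_card_eq hinf (K₀ + 2 * M + 1)
      have := hK₀ M F (fun x hx => (hF hx).1.2) (fun x hx => hM.trans_le (hF hx).2)
      omega)
  have hmem : ∀ n, E n ∈ outerEigenvalues a b := fun n => hrange ▸ Set.mem_range_self n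
  refine ⟨E, ⟨hinj, fun n => (hmem n).1, fun n => ?_, ?_, hanti⟩, hrange⟩
  · exact finrank_eigenspace_eq_one (pot a b) (pot_bounded a b) (hmem n).2
  · rw [hrange]
    exact spectrum_opPot a b

/-- Listing the eigenvalues by distance turns the linear count in `M` into a Gaussian decay. -/
theorem exists_gaussian_bound {a b : ℝ} {E : ℕ → ℝ} (hinj : Function.Injective E)
    (hanti : Antitone fun n => edgeDist (E n)) (hrange : Set.range E = outerEigenvalues a b) :
    ∃ c : ℝ, 0 < c ∧ ∃ C : ℝ, ∀ n : ℕ,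
      edgeDist (E n) ≤ C * Real.exp (-c * ((n : ℝ) + 1) ^ 2) := by
  obtain ⟨K₀, hK₀⟩ := exists_count_bound a b
  have hmem : ∀ n, E n ∈ outerEigenvalues a b := fun n => hrange ▸ Set.mem_range_self n
  -- the first `n + 1` eigenvalues all have distance at least `edgeDist (E n)`
  have hstep : ∀ n M : ℕ, K₀ + 2 * M < n + 1 →
      edgeDist (E n) ≤ 4 * Real.exp (-((M : ℝ) ^ 2 / 50)) := by
    intro n M hnM
    by_contra! hlt
    have h := hK₀ M ((Finset.range (n + 1)).image E)
      (fun x hx => by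
        obtain ⟨i, -, rfl⟩ := Finset.mem_image.1 hx
        exact (hmem i).2)
      (fun x hx => by
        obtain ⟨i, hi, rfl⟩ := Finset.mem_image.1 hx
        exact hlt.trans_le (hanti (Nat.lt_succ_iff.1 (Finset.mem_range.1 hi))))
    rw [Finset.card_image_of_injective _ hinj, Finset.card_range] at h
    omega
  set D := edgeDist (E 0) with hD
  have hD0 : 0 ≤ D := Metric.infDist_nonneg
  refine ⟨1 / 5000, by norm_num, max 4 (D * Real.exp (1 / 5000 * (2 * (K₀ : ℝ) + 10) ^ 2)),
    fun n => ?_⟩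
  rcases le_or_gt (2 * K₀ + 10) (n + 1) with h | h
  · -- the choice `M = (n + 1) / 5` leaves room for the constant `K₀`
    have h1 := hstep n ((n + 1) / 5) (by omega)
    have h2 : ((n : ℝ) + 1) / 10 ≤ (((n + 1) / 5 : ℕ) : ℝ) := by
      have : n + 1 ≤ 10 * ((n + 1) / 5) := by omega
      have h3 : ((n + 1 : ℕ) : ℝ) ≤ ((10 * ((n + 1) / 5) : ℕ) : ℝ) := by exact_mod_cast this
      push_cast at h3 ⊢
      linarith
    refine h1.trans (mul_le_mul (le_max_left _ _) (Real.exp_le_exp.2 ?_) (Real.exp_pos _).le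
      (by positivity))
    have := pow_le_pow_left₀ (by positivity) h2 2
    linarith
  · have h1 : edgeDist (E n) ≤ D := hanti (Nat.zero_le n)
    have h2 : (n : ℝ) + 1 ≤ 2 * K₀ + 10 := by exact_mod_cast h.le
    have h3 := pow_le_pow_left₀ (by positivity) h2 2
    calc edgeDist (E n) ≤ D := h1
      _ ≤ D * Real.exp (1 / 5000 * (2 * (K₀ : ℝ) + 10) ^ 2 + -(1 / 5000) * ((n : ℝ) + 1) ^ 2) :=
        le_mul_of_one_le_right hD0 (Real.one_le_exp (by linarith))
      _ = D * Real.exp (1 / 5000 * (2 * (K₀ : ℝ) + 10) ^ 2) *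
          Real.exp (-(1 / 5000) * ((n : ℝ) + 1) ^ 2) := by
        rw [Real.exp_add, mul_assoc]
      _ ≤ _ := mul_le_mul_of_nonneg_right (le_max_right _ _) (Real.exp_pos _).le

/-- If the largest distance is less than `1`, the constant in front of the Gaussian can be absorbed
into the rate. -/
theorem exists_gaussian_bound_of_lt_one {d : ℕ → ℝ} (hanti : Antitone d)
    (h0 : d 0 < 1) {c C : ℝ} (hc : 0 < c)
    (h : ∀ n : ℕ, d n ≤ C * Real.exp (-c * ((n : ℝ) + 1) ^ 2)) :
    ∃ c' : ℝ, 0 < c' ∧ ∀ n : ℕ, d n ≤ Real.exp (-c' * ((n : ℝ) + 1) ^ 2) := by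
  obtain ⟨N, hN⟩ := exists_nat_gt (2 / c * max C 1)
  set q := max (d 0) (1 / 2) with hq
  have hq0 : 0 < q := lt_max_of_lt_right (by norm_num)
  have hq1 : q < 1 := max_lt h0 (by norm_num)
  have hlq : 0 < -Real.log q := neg_pos.2 (Real.log_neg hq0 hq1)
  refine ⟨min (c / 2) (-Real.log q / ((N : ℝ) + 1) ^ 2), by positivity, fun n => ?_⟩
  have hn0 : (0 : ℝ) ≤ n := n.cast_nonneg
  rcases le_or_gt n N with hnN | hnN
  · have hnN' : (n : ℝ) + 1 ≤ N + 1 := by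
      have : (n : ℝ) ≤ N := by exact_mod_cast hnN
      linarith
    calc d n ≤ q := (hanti (Nat.zero_le n)).trans (le_max_left _ _)
      _ = Real.exp (Real.log q) := (Real.exp_log hq0).symm
      _ ≤ _ := by
        refine Real.exp_le_exp.2 ?_
        have h1 := mul_le_mul (min_le_right (c / 2) (-Real.log q / ((N : ℝ) + 1) ^ 2))
          (pow_le_pow_left₀ (by positivity) hnN' 2) (by positivity) (by positivity)
        rw [div_mul_cancel₀ _ (by positivity)] at h1
        linarith
  · have hnN' : (N : ℝ) ≤ n := by exact_mod_cast hnN.le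
    have hC : C ≤ Real.exp (c / 2 * ((n : ℝ) + 1) ^ 2) := by
      have h1 : max C 1 ≤ c / 2 * n := by
        have h2 : 2 / c * max C 1 < n := hN.trans_le hnN'
        have h3 := mul_lt_mul_of_pos_left h2 (half_pos hc)
        have h4 : c / 2 * (2 / c * max C 1) = max C 1 := by
          field_simp
        rw [h4] at h3
        exact h3.le
      have h5 : c / 2 * n ≤ c / 2 * ((n : ℝ) + 1) ^ 2 := by
        refine mul_le_mul_of_nonneg_left ?_ (half_pos hc).le
        nlinarith
      have h6 := Real.add_one_le_exp (c / 2 * ((n : ℝ) + 1) ^ 2)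
      linarith [le_max_left C 1]
    calc d n ≤ C * Real.exp (-c * ((n : ℝ) + 1) ^ 2) := h n
      _ ≤ Real.exp (c / 2 * ((n : ℝ) + 1) ^ 2) * Real.exp (-c * ((n : ℝ) + 1) ^ 2) :=
        mul_le_mul_of_nonneg_right hC (Real.exp_pos _).le
      _ = Real.exp (-(c / 2) * ((n : ℝ) + 1) ^ 2) := by
        rw [← Real.exp_add]
        congr 1
        ring
      _ ≤ _ := by
        refine Real.exp_le_exp.2 ?_
        have := mul_le_mul_of_nonneg_right
          (min_le_left (c / 2) (-Real.log q / ((N : ℝ) + 1) ^ 2)) (sq_nonneg ((n : ℝ) + 1))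
        linarith

/-- For `V(1) = V(2) = 0` the potential is bounded by a constant less than `1`. -/
theorem edgeDist_lt_one {x : ℝ}
    (hx : Module.End.HasEigenvalue (opPot 0 0 : HalfLine →ₗ[ℂ] HalfLine) (x : ℂ)) :
    edgeDist x < 1 := by
  have hl3 : 1 < Real.log 3 := by
    rw [Real.lt_log_iff_exp_lt (by norm_num)]
    linarith [Real.exp_one_lt_d9]
  set q := 1 / 3 * (1 + 2 / Real.log 3) with hq
  have hq1 : q < 1 := by
    have : 2 / Real.log 3 < 2 := by rw [div_lt_iff₀ (by linarith)]; linarith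
    rw [hq]; linarith
  have hq0 : 0 ≤ q := by positivity
  have hpot : ∀ n, 1 ≤ n → |pot 0 0 n| ≤ q := by
    intro n hn
    rcases lt_or_ge n 3 with h | h
    · have : pot 0 0 n = 0 := by
        unfold pot
        split_ifs <;> first | rfl | omega
      rw [this, abs_zero]
      exact hq0
    · have hn3 : (3 : ℝ) ≤ n := by exact_mod_cast h
      rw [pot_eq_osc 0 0 h, abs_mul, abs_pow, abs_neg, abs_one, one_pow, one_mul,
        abs_of_pos (osc_pos (by linarith)), osc, hq]
      have hl : Real.log 3 ≤ Real.log n := Real.log_le_log (by norm_num) hn3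
      have h1 : 1 / (n : ℝ) ≤ 1 / 3 := one_div_le_one_div_of_le (by norm_num) hn3
      have h2 : 2 / Real.log n ≤ 2 / Real.log 3 :=
        div_le_div_of_nonneg_left (by norm_num) (by linarith) hl
      have h3 : 0 < Real.log n := by linarith
      exact mul_le_mul h1 (by linarith) (by positivity) (by norm_num)
  have hspec : x ∈ spectrum ℝ (opH (pot 0 0) (pot_bounded 0 0)) := by
    rw [← spectrum.algebraMap_mem_iff ℂ, ContinuousLinearMap.spectrum_eq]
    exact hx.mem_spectrum
  exact (edgeDist_le hq0 (abs_le_of_mem_spectrum _ _ hpot hspec)).trans_lt hq1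

/-! ### Failure of absolute continuity and the conjecture -/

/-- An eigenvector at energy zero has a point mass at `0` as its spectral measure. -/
theorem not_purelyAbsolutelyContinuous {H : HalfLine →L[ℂ] HalfLine}
    (h : Module.End.HasEigenvalue (H : HalfLine →ₗ[ℂ] HalfLine) 0) :
    ¬ PurelyAbsolutelyContinuousOn H (Set.Icc (-2) 2) := by
  obtain ⟨ψ, hψ⟩ := h.exists_hasEigenvector
  have hHψ : H ψ = 0 := by simpa using hψ.apply_eq_smul
  intro hac
  set μ : MeasureTheory.Measure ℝ :=
    ENNReal.ofReal (‖ψ‖ ^ 2) • MeasureTheory.Measure.dirac (0 : ℝ) with hμ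
  have hspec : IsSpectralMeasure H ψ μ := by
    refine ⟨?_, ⟨1, ?_⟩, fun k => ?_⟩
    · exact MeasureTheory.Measure.smul_finite _ ENNReal.ofReal_ne_top
    · rw [hμ, MeasureTheory.Measure.smul_apply,
        MeasureTheory.Measure.dirac_apply' _ measurableSet_Icc.compl]
      simp
    · rw [hμ, MeasureTheory.integral_smul_measure, MeasureTheory.integral_dirac,
        ENNReal.toReal_ofReal (by positivity)]
      cases k with
      | zero =>
        rw [pow_zero, pow_zero, one_apply_eq_self, inner_self_eq_norm_sq_to_K]
        simp
      | succ k =>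
        rw [pow_succ, mul_apply_eq_comp, hHψ]
        simp
  have h0 := hac ψ μ hspec (MeasureTheory.measure_singleton (0 : ℝ))
  rw [MeasureTheory.Measure.restrict_apply (measurableSet_singleton 0),
    Set.inter_eq_left.2 (Set.singleton_subset_iff.2 (by norm_num)), hμ,
    MeasureTheory.Measure.smul_apply, MeasureTheory.Measure.dirac_apply_of_mem (Set.mem_singleton _)] at h0
  exact hψ.2 (by simpa using h0)

theorem summable_inv_log {d : ℕ → ℝ} (hd : ∀ n, 0 < d n) {c C : ℝ} (hc : 0 < c)
    (h : ∀ n : ℕ, d n ≤ C * Real.exp (-c * ((n : ℝ) + 1) ^ 2)) :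
    Summable fun n => 1 / Real.log (1 / d n) := by
  obtain ⟨N, hN⟩ := exists_nat_gt (2 / c * |Real.log C|)
  have hC : 0 < C := pos_of_mul_pos_left ((hd 0).trans_le (h 0)) (Real.exp_pos _).le
  have hs : Summable fun n : ℕ => 2 / c * (1 / ((n : ℝ) + 1) ^ 2) := by
    refine Summable.mul_left _ ?_
    have := (summable_nat_add_iff 1).2 (Real.summable_one_div_nat_pow.2 (one_lt_two))
    exact_mod_cast this
  refine Summable.of_norm_bounded_eventually_nat hs ?_
  filter_upwards [eventually_ge_atTop N] with n hn
  have hn' : (N : ℝ) ≤ n := by exact_mod_cast hn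
  have hn0 : (0 : ℝ) ≤ n := n.cast_nonneg
  have h1 : c / 2 * ((n : ℝ) + 1) ^ 2 ≤ Real.log (1 / d n) := by
    have h2 := Real.log_le_log (hd n) (h n)
    rw [Real.log_mul hC.ne' (Real.exp_pos _).ne', Real.log_exp] at h2
    rw [one_div, Real.log_inv]
    have h3 : |Real.log C| ≤ c / 2 * n := by
      have h4 := mul_lt_mul_of_pos_left (hN.trans_le hn') (half_pos hc)
      have h5 : c / 2 * (2 / c * |Real.log C|) = |Real.log C| := by
        field_simp
      rw [h5] at h4
      exact h4.le
    have h6 : c / 2 * n ≤ c / 2 * ((n : ℝ) + 1) ^ 2 := by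
      refine mul_le_mul_of_nonneg_left ?_ (half_pos hc).le
      nlinarith
    linarith [le_abs_self (Real.log C)]
  have h0 : 0 < c / 2 * ((n : ℝ) + 1) ^ 2 := by positivity
  rw [Real.norm_of_nonneg (one_div_nonneg.2 (h0.le.trans h1))]
  refine (one_div_le_one_div_of_le h0 h1).trans (le_of_eq ?_)
  field_simp

end DiscreteSchrodinger

theorem theorem1p1 :
    -- a square-summable solution at energy zero, for all values of V(1) and V(2)
    (∀ a b : ℝ, ∃ u : ℕ → ℝ, u ≠ 0 ∧
      (∀ n : ℕ, 1 ≤ n →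
        u (n + 1) + u (n - 1) + DiscreteSchrodinger.pot a b n * u n = 0 * u n) ∧
      Summable fun n => u n ^ 2) ∧
    -- the discrete eigenvalues, for V(1) = V(2) = 0; the index n stands for the (n+1)-st eigenvalue
    (∃ E : ℕ → ℝ,
      DiscreteSchrodinger.EnumeratesDiscreteSpectrum (DiscreteSchrodinger.opPot 0 0) E ∧
      ∃ c : ℝ, 0 < c ∧
        ∀ n : ℕ, DiscreteSchrodinger.edgeDist (E n) ≤ Real.exp (-c * ((n : ℝ) + 1) ^ 2)) ∧
    -- the discrete eigenvalues, for all values of V(1) and V(2)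
    (∀ a b : ℝ, ∃ E : ℕ → ℝ,
      DiscreteSchrodinger.EnumeratesDiscreteSpectrum (DiscreteSchrodinger.opPot a b) E ∧
      ∃ c : ℝ, 0 < c ∧ ∃ C : ℝ,
        ∀ n : ℕ, DiscreteSchrodinger.edgeDist (E n) ≤ C * Real.exp (-c * ((n : ℝ) + 1) ^ 2)) ∧
    -- embedded singular spectrum after a suitable choice of V(1), and the failure of the conjecture
    (∃ a : ℝ,
      Module.End.HasEigenvalue
        (DiscreteSchrodinger.opPot a 0 :
          DiscreteSchrodinger.HalfLine →ₗ[ℂ] DiscreteSchrodinger.HalfLine) 0 ∧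
      ¬ DiscreteSchrodinger.PurelyAbsolutelyContinuousOn (DiscreteSchrodinger.opPot a 0)
        (Set.Icc (-2) 2) ∧
      ∃ E : ℕ → ℝ,
        DiscreteSchrodinger.EnumeratesDiscreteSpectrum (DiscreteSchrodinger.opPot a 0) E ∧
        Summable fun n => 1 / Real.log (1 / DiscreteSchrodinger.edgeDist (E n))) := by
  refine ⟨DiscreteSchrodinger.exists_l2_solution, ?_, fun a b => ?_, ?_⟩
  · obtain ⟨E, hE, hrange⟩ := DiscreteSchrodinger.exists_enumeration 0 0
    obtain ⟨c, hc, C, hC⟩ :=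
      DiscreteSchrodinger.exists_gaussian_bound hE.1 hE.2.2.2.2 hrange
    have h0 : E 0 ∈ DiscreteSchrodinger.outerEigenvalues 0 0 := hrange ▸ Set.mem_range_self 0
    exact ⟨E, hE, DiscreteSchrodinger.exists_gaussian_bound_of_lt_one
      hE.2.2.2.2
      (DiscreteSchrodinger.edgeDist_lt_one h0.2) hc hC⟩
  · obtain ⟨E, hE, hrange⟩ := DiscreteSchrodinger.exists_enumeration a b
    exact ⟨E, hE, DiscreteSchrodinger.exists_gaussian_bound hE.1 hE.2.2.2.2 hrange⟩
  · obtain ⟨a, ha⟩ := DiscreteSchrodinger.exists_zero_eigenvalue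
    obtain ⟨E, hE, hrange⟩ := DiscreteSchrodinger.exists_enumeration a 0
    obtain ⟨c, hc, C, hC⟩ :=
      DiscreteSchrodinger.exists_gaussian_bound hE.1 hE.2.2.2.2 hrange
    exact ⟨a, ha, DiscreteSchrodinger.not_purelyAbsolutelyContinuous ha, E, hE,
      DiscreteSchrodinger.summable_inv_log
        (fun n => DiscreteSchrodinger.edgeDist_pos (hE.2.1 n)) hc hC⟩
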